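/- Manifolds are smooth, finite-dimensional, without boundary, and not necessarily connected; a Riemannian manifold $M$ carries a smooth Riemannian metric and its distance function $d_M$ (the infimum of lengths of $C^1$ paths; $d_M=\infty$ between different connected components). For a map $f:M\to N$ between Riemannian manifolds put \[ \mathrm{Lip}(f):=\sup\left\{\frac{d_N(f(x),f(y))}{d_M(x,y)}\;\middle|\;x,y\in M,\ x\neq y\right\}\in[0,\infty], \] where a pair with $d_M(x,y)=\infty$ contributes $0$. The map $f$ is Lipschitz if there is a finite $K\ge 0$ with $d_N(f(x),f(y))\le K\,d_M(x,y)$ for all $x,y\in M$ (with $0\cdot\infty=0$). For a Lipschitz map $F:M\to N$ and $x\in M$, Clarke's generalized differential of $F$ at $x$ is \[ \partial F(x):=\mathrm{Conv}\Big(\Big\{\lim_{i\to\infty}dF_{x_i}\;\Big|\;x_i\to x,\ F\text{ is differentiable at every }x_i,\ \text{the limit exists}\Big\}\Big)\subset\mathrm{Hom}(T_xM,T_{F(x)}N), \] where $\mathrm{Conv}$ denotes the convex hull and the limit is taken in local trivializations of the tangent bundles near $x$ and $F(x)$ (the choice does not matter). The point $x$ is called non-singular for $F$ if every element of $\partial F(x)$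 has maximal rank $\min(\dim M,\dim N)$, and singular otherwise. **Theorem.** Let $F:M\to N$ be a Lipschitz map from a compact Riemannian manifold $M$ into a Riemannian manifold $N$, where $\dim M\le\dim N$. If $F$ has no singular points on $M$, then for every $\eta>0$ there exists a smooth immersion $f_\eta:M\to N$ (that is, a $C^\infty$ map whose differential is injective at every point) such that \[ d_N(F(x),f_\eta(x))<\eta\quad\text{for all }x\in M,\qquad \mathrm{Lip}(f_\eta)\le \mathrm{Lip}(F)\,(1+\eta). \] -/

import Mathlib

open Set Filter Bundle
open scoped Manifold ContDiff Topology ENNReal NNReal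

noncomputable section

section Lipschitz

variable {X Y : Type*} [EMetricSpace X] [EMetricSpace Y]

/-- The Lipschitz constant `Lip(f) = sup { d(f x, f y) / d(x, y) | x ≠ y }`, as an element of
`[0, ∞]`. A pair of points at infinite distance (points of a disconnected manifold that lie in
different connected components) contributes the quotient `0`. -/
def lipschitzConstant (f : X → Y) : ℝ≥0∞ :=
  ⨆ (x : X) (y : X) (_ : x ≠ y), edist (f x) (f y) / edist x y

end Lipschitz

section Clarke

variable {E : Type*} [NormedAddCommGroup E] [NormedSpace ℝ E]
  {E' : Type*} [NormedAddCommGroup E'] [NormedSpace ℝ E']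
  {H : Type*} [TopologicalSpace H] (I : ModelWithCorners ℝ E H)
  {H' : Type*} [TopologicalSpace H'] (J : ModelWithCorners ℝ E' H')
  {M : Type*} [TopologicalSpace M] [ChartedSpace H M] [IsManifold I 1 M]
  {N : Type*} [TopologicalSpace N] [ChartedSpace H' N] [IsManifold J 1 N]

/-- The limits of the differentials `dF` along sequences of points of differentiability of `F` that
converge to `x`. The differentials `dF_{u i} : T_{u i} M → T_{F (u i)} N` at different points are
compared in the trivializations of the two tangent bundles given by the preferred charts at `x` and
at `F x`; over `x` and `F x` themselves these trivializations are the identifications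
`T_x M = E` and `T_{F x} N = E'`, so that a limit is a linear map `T_x M → T_{F x} N`. -/
def limitingDifferentials (F : M → N) (x : M) : Set (E →L[ℝ] E') :=
  {A | ∃ u : ℕ → M, Tendsto u atTop (𝓝 x) ∧ (∀ i, MDifferentiableAt I J F (u i)) ∧
    Tendsto (fun i ↦ inTangentCoordinates I J id F (fun y ↦ mfderiv I J F y) x (u i)) atTop (𝓝 A)}

/-- Clarke's generalized differential `∂F(x)`: the convex hull of all limits of differentials `dF`
at points of differentiability of `F` converging to `x`. -/
def generalizedDifferential (F : M → N) (x : M) : Set (E →L[ℝ] E') :=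
  convexHull ℝ (limitingDifferentials I J F x)

/-- A point `x` is non-singular for `F` (in the sense of Clarke) if every element of `∂F(x)` is of
maximal rank. -/
def IsNonsingularPoint (F : M → N) (x : M) : Prop :=
  ∀ A ∈ generalizedDifferential I J F x,
    Module.finrank ℝ (LinearMap.range (A : E →ₗ[ℝ] E')) =
      min (Module.finrank ℝ E) (Module.finrank ℝ E')

end Clarke

end

/-! Clarke's condition is turned into a property of increments that survives averaging. In charts,
the differentials of `g` existing near `a` stay close to the compact convex set `∂g(a)`, all of
whose elements are injective. For each vector `v` the values `A v`, `A ∈ ∂g(a)`, thus form a compact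
convex set at distance at least `c‖v‖` from the origin, and a hyperplane separates it from the
origin. A mean value inequality then yields one functional `l`, depending on `v` but not on the base
point, with `l (g (y + v) - g y) ≥ (c/2)‖v‖` for all `y` and `y + v` near `a`. This is
`ConvexlyExpandingAt`, obtained in `convexlyExpandingAt_of_injective`.

Convex expansion and a Lipschitz bound both ask that `g z - g y` lie in a closed convex set
depending only on `z - y`. Convolution respects such a constraint, and returning to `g` through a
cut-off function costs only a small relative error (`exists_local_smoothing`), which the slack in
both bounds absorbs (`IsAdmissibleAt.exists_stable_constraint`). Finitely many such local smoothings
cover the compact source (`exists_contMDiff_isAdmissibleAt`).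

The resulting smooth map is an immersion, since an expanding map has no kernel direction. Its local
Lipschitz bounds become global by subdividing almost shortest paths
(`edist_le_of_locally_lipschitz`). The factor `1 + η` is attainable because near each point the
distance agrees with a fixed norm in the chart up to a factor close to `1`
(`exists_seminorm_chart`). -/

section

open MeasureTheory Metric Manifold

/-! ### Mollifiers and local smoothing under convex constraints on increments. -/

section Mollification

variable {E : Type*} [NormedAddCommGroup E] [NormedSpace ℝ E] [FiniteDimensional ℝ E]
  [MeasurableSpace E] [BorelSpace E]
  {E' : Type*} [NormedAddCommGroup E'] [NormedSpace ℝ E']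

/-- In a finite-dimensional space there are smooth averaging measures of arbitrarily small
support. -/
theorem exists_mollifier (ν : Measure E) [ν.IsAddHaarMeasure] {ε : ℝ} (hε : 0 < ε) :
    ∃ μ : Measure E, IsProbabilityMeasure μ ∧ μ ≪ ν ∧ (∀ᵐ w ∂μ, w ∈ ball (0 : E) ε) ∧
      ∀ {g : E → E'}, LocallyIntegrable g ν →
        (∀ y, Integrable (fun w ↦ g (y - w)) μ) ∧ ContDiff ℝ ∞ (fun y ↦ ∫ w, g (y - w) ∂μ) := by
  -- The measure has the normalized bump as density, so averaging `g (y - w)` over it is convolution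
  -- with the bump.
  let φ : ContDiffBump (0 : E) := ⟨ε / 2, ε, by positivity, by linarith⟩
  have hm : Measurable (fun w ↦ ENNReal.ofReal (φ.normed ν w)) :=
    (φ.continuous_normed.measurable).ennreal_ofReal
  have hfin : ∀ᵐ w ∂ν, ENNReal.ofReal (φ.normed ν w) < ⊤ := by simp
  have hto : ∀ w, (ENNReal.ofReal (φ.normed ν w)).toReal = φ.normed ν w := fun w ↦
    ENNReal.toReal_ofReal (φ.nonneg_normed w)
  refine ⟨ν.withDensity fun w ↦ ENNReal.ofReal (φ.normed ν w), ⟨?_⟩,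
    withDensity_absolutelyContinuous _ _, ?_, fun {g} hg ↦ ⟨fun y ↦ ?_, ?_⟩⟩
  · rw [withDensity_apply _ MeasurableSet.univ, Measure.restrict_univ,
      ← ofReal_integral_eq_lintegral_ofReal φ.integrable_normed
        (Eventually.of_forall φ.nonneg_normed), φ.integral_normed, ENNReal.ofReal_one]
  · rw [ae_withDensity_iff hm]
    filter_upwards with w hw
    by_contra h
    apply hw
    have : w ∉ Function.support (φ.normed ν) := by rwa [φ.support_normed_eq]
    rw [Function.notMem_support.1 this, ENNReal.ofReal_zero]
  · rw [integrable_withDensity_iff_integrable_smul' hm hfin]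
    simp only [hto]
    exact (HasCompactSupport.convolutionExists_left (ContinuousLinearMap.lsmul ℝ ℝ)
      φ.hasCompactSupport_normed φ.continuous_normed hg) y
  · have h : ∀ y, ∫ w, g (y - w) ∂(ν.withDensity fun w ↦ ENNReal.ofReal (φ.normed ν w)) =
        convolution (φ.normed ν) g (ContinuousLinearMap.lsmul ℝ ℝ) ν y := by
      intro y
      rw [integral_withDensity_eq_integral_toReal_smul hm hfin]
      simp only [hto]
      rfl
    simp only [h]
    exact HasCompactSupport.contDiff_convolution_left (n := ⊤) (ContinuousLinearMap.lsmul ℝ ℝ)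
      φ.hasCompactSupport_normed φ.contDiff_normed hg

/-- Local smoothing of a map `g`. Every constraint `g z - g y ∈ S i (z - y)` with closed convex
fibers which holds near `p i` survives up to an arbitrarily small relative error. -/
theorem exists_local_smoothing [FiniteDimensional ℝ E'] {g : E → E'} {a : E} {R : ℝ} (hR : 0 < R)
    (hg : ContinuousOn g (closedBall a R)) {ι : Type*} [Finite ι] (p : ι → E) (r : ι → ℝ)
    (hr : ∀ i, 0 < r i) (S : ι → E → Set E') (hSc : ∀ i v, Convex ℝ (S i v))
    (hScl : ∀ i v, IsClosed (S i v)) (hsub : ∀ i, ball (p i) (2 * r i) ⊆ closedBall a R)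
    (hS : ∀ i, ∀ y ∈ ball (p i) (2 * r i), ∀ z ∈ ball (p i) (2 * r i), g z - g y ∈ S i (z - y))
    {δ : ℝ} (hδ : 0 < δ) :
    ∃ h : E → E', (∀ y ∉ closedBall a (R / 2), h y = g y) ∧
      (∀ y, ‖h y - g y‖ ≤ δ) ∧
      (∀ i, ∀ y ∈ ball (p i) (r i), ∀ z ∈ ball (p i) (r i),
        ∃ w ∈ S i (z - y), ‖h z - h y - w‖ ≤ δ * ‖z - y‖) ∧
      (∀ y ∈ ball a (R / 4), ContDiffAt ℝ ∞ h y) ∧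
      ∀ y, ContDiffAt ℝ ∞ g y → ContDiffAt ℝ ∞ h y := by
  let b : ContDiffBump a := ⟨R / 4, R / 2, by positivity, by linarith⟩
  have hbs : ContDiff ℝ ∞ (b : E → ℝ) := b.contDiff
  obtain ⟨Λ, hΛ⟩ := hbs.lipschitzWith_of_hasCompactSupport b.hasCompactSupport (by simp)
  -- The variation of the cut-off `b` multiplies the uniform error of the mollification, so that
  -- error must be small relative to the Lipschitz constant `Λ` of `b`.
  obtain ⟨δ', hδ', hδδ, hδΛ⟩ : ∃ δ' > 0, δ' ≤ δ ∧ Λ * δ' ≤ δ := by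
    refine ⟨δ / (1 + Λ), by positivity, div_le_self hδ.le (by simp), ?_⟩
    rw [mul_div_assoc', div_le_iff₀ (by positivity)]
    nlinarith [Λ.2]
  have huc : UniformContinuousOn g (closedBall a R) :=
    (isCompact_closedBall a R).uniformContinuousOn_of_continuous hg
  obtain ⟨ε₀, hε₀, huc⟩ := Metric.uniformContinuousOn_iff.1 huc δ' hδ'
  -- `ε ≤ R / 2` and `ε ≤ ε₀` give uniform closeness on the support of `b`; `ε ≤ r i` keeps the
  -- translates of `ball (p i) (r i)` inside the doubled ball, where the constraint is known.
  obtain ⟨ε, hε, hεR, hεε, hεr⟩ : ∃ ε > 0, ε ≤ R / 2 ∧ ε ≤ ε₀ ∧ ∀ i, ε ≤ r i := by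
    rcases isEmpty_or_nonempty ι with hι | hι
    · exact ⟨min (R / 2) ε₀, by positivity, min_le_left _ _, min_le_right _ _, fun i ↦ hι.elim i⟩
    · obtain ⟨j, hj⟩ := Finite.exists_min r
      exact ⟨min (min (R / 2) ε₀) (r j), by have := hr j; positivity,
        (min_le_left _ _).trans (min_le_left _ _), (min_le_left _ _).trans (min_le_right _ _),
        fun i ↦ (min_le_right _ _).trans (hj i)⟩
  obtain ⟨μ, hμ, -, hsupp, hμg⟩ := exists_mollifier (E' := E') (Measure.addHaar : Measure E) hε
  -- Nothing is known about `g` off the ball; truncation makes it integrable without changing the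
  -- averages that matter.
  let g' := (closedBall a R).indicator g
  have hg' : LocallyIntegrable g' (Measure.addHaar : Measure E) :=
    ((hg.integrableOn_compact (isCompact_closedBall a R)).integrable_indicator
      measurableSet_closedBall).locallyIntegrable
  obtain ⟨hint, hsm⟩ := hμg hg'
  let gε : E → E' := fun y ↦ ∫ w, g' (y - w) ∂μ
  have hg'eq : ∀ y ∈ closedBall a R, g' y = g y := fun y hy ↦ indicator_of_mem hy g
  have hnear : ∀ y, ball y ε ⊆ closedBall a R → ‖gε y - g y‖ ≤ δ' := by
    intro y hy
    have hyR : y ∈ closedBall a R := hy (mem_ball_self hε)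
    have : gε y ∈ closedBall (g y) δ' := by
      refine (convex_closedBall _ _).integral_mem isClosed_closedBall ?_ (hint y)
      filter_upwards [hsupp] with w hw
      have hyw : y - w ∈ ball y ε := by simpa [mem_ball, dist_eq_norm] using hw
      rw [hg'eq _ (hy hyw), mem_closedBall]
      exact (huc _ (hy hyw) _ hyR ((mem_ball.1 hyw).trans_le hεε)).le
    simpa [dist_eq_norm] using this
  have hball : ∀ i, ∀ y ∈ ball (p i) (r i), ball y ε ⊆ ball (p i) (2 * r i) := by
    intro i y hy
    apply ball_subset_ball'
    have := mem_ball.1 hy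
    linarith [hεr i]
  -- The increment of the average is the average of the increments, each of which lies in the closed
  -- convex set `S i (z - y)`.
  have hSε : ∀ i, ∀ y ∈ ball (p i) (r i), ∀ z ∈ ball (p i) (r i), gε z - gε y ∈ S i (z - y) := by
    intro i y hy z hz
    rw [← integral_sub (hint z) (hint y)]
    refine (hSc i _).integral_mem (hScl i _) ?_ ((hint z).sub (hint y))
    filter_upwards [hsupp] with w hw
    have hy' : y - w ∈ ball (p i) (2 * r i) :=
      hball i y hy (by simpa [mem_ball, dist_eq_norm] using hw)
    have hz' : z - w ∈ ball (p i) (2 * r i) :=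
      hball i z hz (by simpa [mem_ball, dist_eq_norm] using hw)
    rw [hg'eq _ (hsub i hy'), hg'eq _ (hsub i hz')]
    simpa using hS i _ hy' _ hz'
  refine ⟨fun y ↦ g y + b y • (gε y - g y), fun y hy ↦ ?_, fun y ↦ ?_, fun i y hy z hz ↦ ?_,
    fun y hy ↦ ?_, fun y hy ↦ ?_⟩
  · have : b y = 0 := b.zero_of_le_dist (by simpa using (not_le.1 (mem_closedBall.not.1 hy)).le)
    simp [this]
  · by_cases hy : y ∈ closedBall a (R / 2)
    · have h1 : ‖gε y - g y‖ ≤ δ' := hnear y fun w hw ↦ by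
        have h1 := mem_ball.1 hw
        have h2 := mem_closedBall.1 hy
        exact mem_closedBall.2 ((dist_triangle w y a).trans (by linarith))
      simp only [add_sub_cancel_left, norm_smul, Real.norm_eq_abs, abs_of_nonneg b.nonneg]
      calc b y * ‖gε y - g y‖ ≤ 1 * δ' := by gcongr; exact b.le_one
        _ ≤ δ := by linarith
    · have : b y = 0 := b.zero_of_le_dist (by simpa using (not_le.1 (mem_closedBall.not.1 hy)).le)
      simp [this, hδ.le]
  · have hb2 : ball (p i) (r i) ⊆ ball (p i) (2 * r i) := ball_subset_ball (by linarith [hr i])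
    -- With the weight frozen at `b z`, the increment is a convex combination of two increments in
    -- `S i (z - y)`. What remains is `(b z - b y) • (gε y - g y)`, of size at most `Λ δ' ‖z - y‖`.
    refine ⟨(1 - b z) • (g z - g y) + b z • (gε z - gε y),
      hSc i _ (hS i y (hb2 hy) z (hb2 hz)) (hSε i y hy z hz) (by linarith [b.le_one (x := z)])
        b.nonneg (by ring), ?_⟩
    have : g z + b z • (gε z - g z) - (g y + b y • (gε y - g y)) -
        ((1 - b z) • (g z - g y) + b z • (gε z - gε y)) = (b z - b y) • (gε y - g y) := by
      module
    rw [this, norm_smul]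
    calc ‖b z - b y‖ * ‖gε y - g y‖ ≤ (Λ * ‖z - y‖) * δ' := by
          gcongr
          · simpa [dist_eq_norm] using hΛ.dist_le_mul z y
          · exact hnear y ((hball i y hy).trans (hsub i))
      _ = (Λ * δ') * ‖z - y‖ := by ring
      _ ≤ δ * ‖z - y‖ := by gcongr
  · have h1 : ContDiffAt ℝ ∞ gε y := hsm.contDiffAt
    apply h1.congr_of_eventuallyEq
    filter_upwards [isOpen_ball.mem_nhds hy] with w hw
    have : b w = 1 := b.one_of_mem_closedBall (ball_subset_closedBall hw)
    simp [this]
  · exact hy.add (hbs.contDiffAt.smul (hsm.contDiffAt.sub hy))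

end Mollification

/-! ### Convex expansion and its invariance under changes of coordinates. -/

section Expanding

variable {E : Type*} [NormedAddCommGroup E]
  {E' : Type*} [NormedAddCommGroup E'] [NormedSpace ℝ E']

/-- Near `a`, the closed convex hull of the increments of `g` along any vector `v` stays at
distance at least `c * ‖v‖` from the origin. -/
def ConvexlyExpandingAt (g : E → E') (a : E) : Prop :=
  ∃ c > 0, ∃ r > 0, ∀ v : E, ∃ l : E' →L[ℝ] ℝ, ‖l‖ ≤ 1 ∧
    ∀ y ∈ ball a r, y + v ∈ ball a r → c * ‖v‖ ≤ l (g (y + v) - g y)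

theorem ConvexlyExpandingAt.congr {g g' : E → E'} {a : E} (h : ConvexlyExpandingAt g a)
    (hg : g' =ᶠ[𝓝 a] g) : ConvexlyExpandingAt g' a := by
  obtain ⟨c, hc, r, hr, H⟩ := h
  obtain ⟨s, hs, hs'⟩ := Metric.eventually_nhds_iff_ball.1 hg
  refine ⟨c, hc, min r s, lt_min hr hs, fun v ↦ ?_⟩
  obtain ⟨l, hl, hl'⟩ := H v
  refine ⟨l, hl, fun y hy hyv ↦ ?_⟩
  rw [hs' _ (ball_subset_ball (min_le_right _ _) hy), hs' _ (ball_subset_ball (min_le_right _ _) hyv)]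
  exact hl' y (ball_subset_ball (min_le_left _ _) hy) (ball_subset_ball (min_le_left _ _) hyv)

/-- Along a kernel vector `v` the increments from `a` to `a + t • v` would be `o(t)`, while
expansion bounds them below by `c t ‖v‖`. -/
theorem ConvexlyExpandingAt.fderiv_injective [NormedSpace ℝ E] {g : E → E'} {a : E} (h : ConvexlyExpandingAt g a)
    {A : E →L[ℝ] E'} (hA : HasFDerivAt g A a) : Function.Injective A := by
  obtain ⟨c, hc, r, hr, H⟩ := h
  rw [injective_iff_map_eq_zero]
  intro v hv
  by_contra hv0
  have hvn : 0 < ‖v‖ := norm_pos_iff.2 hv0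
  have h1 := (hasFDerivAt_iff_isLittleO_nhds_zero.1 hA).def (half_pos hc)
  have h2 : ∀ᶠ u in 𝓝 (0 : E), u ∈ ball (0 : E) r := ball_mem_nhds _ hr
  have h3 : Tendsto (fun t : ℝ ↦ t • v) (𝓝[>] 0) (𝓝 0) := by
    have : Tendsto (fun t : ℝ ↦ t • v) (𝓝 0) (𝓝 ((0 : ℝ) • v)) :=
      (continuous_id.smul continuous_const).tendsto _
    rw [zero_smul] at this
    exact this.mono_left nhdsWithin_le_nhds
  obtain ⟨t, ⟨h4, h5⟩, ht⟩ := ((h3.eventually (h1.and h2)).and self_mem_nhdsWithin).exists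
  obtain ⟨l, hl, hl'⟩ := H (t • v)
  have h6 := hl' a (mem_ball_self hr) (by simpa using h5)
  rw [map_smul, hv, smul_zero, sub_zero] at h4
  have h7 : l (g (a + t • v) - g a) ≤ 1 * ‖g (a + t • v) - g a‖ :=
    (le_abs_self _).trans (l.le_of_opNorm_le hl _)
  have h8 : 0 < ‖t • v‖ := by
    rw [norm_smul]
    exact mul_pos (norm_pos_iff.2 (ne_of_gt ht)) hvn
  nlinarith

/-- Invariance under a change of coordinates in the source. -/
theorem ConvexlyExpandingAt.comp_right [NormedSpace ℝ E] {g : E → E'} {a : E} {τ : E → E} {T : E ≃L[ℝ] E}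
    (h : ConvexlyExpandingAt g (τ a)) {K : ℝ≥0} {U : Set E} (hU : U ∈ 𝓝 (τ a))
    (hg : LipschitzOnWith K g U) (hτ : HasStrictFDerivAt τ (T : E →L[ℝ] E) a) :
    ConvexlyExpandingAt (g ∘ τ) a := by
  obtain ⟨c, hc, r, hr, H⟩ := h
  obtain ⟨m, hm, hmT⟩ : ∃ m > 0, ∀ v, m * ‖v‖ ≤ ‖T v‖ := by
    refine ⟨(‖(T.symm : E →L[ℝ] E)‖ + 1)⁻¹, by positivity, fun v ↦ ?_⟩
    rw [inv_mul_le_iff₀ (by positivity)]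
    have := (T.symm : E →L[ℝ] E).le_opNorm (T v)
    simp only [ContinuousLinearEquiv.coe_coe, ContinuousLinearEquiv.symm_apply_apply] at this
    nlinarith [norm_nonneg (T v)]
  obtain ⟨ρ, hρ, hρU⟩ := Metric.mem_nhds_iff.1 hU
  set s := min r ρ with hs
  have hspos : 0 < s := lt_min hr hρ
  -- Chosen so that `K * ε ≤ c * m / 2`: replacing `τ (y + v)` by `τ y + T v` then costs at most
  -- half of the expansion.
  set ε := c * m / (2 * (K + 1)) with hε
  have hεpos : 0 < ε := by positivity
  have h1 : ∀ᶠ q : E × E in 𝓝 (a, a), ‖τ q.1 - τ q.2 - T (q.1 - q.2)‖ ≤ ε * ‖q.1 - q.2‖ :=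
    (hasStrictFDerivAt_iff_isLittleO.1 hτ).def hεpos
  have h2 : ∀ᶠ q : E × E in 𝓝 (a, a), τ q.2 ∈ ball (τ a) s :=
    (hτ.continuousAt.comp (x := (a, a)) continuousAt_snd).eventually (ball_mem_nhds _ hspos)
  have h2' : ∀ᶠ q : E × E in 𝓝 (a, a), τ q.1 ∈ ball (τ a) s :=
    (hτ.continuousAt.comp (x := (a, a)) continuousAt_fst).eventually (ball_mem_nhds _ hspos)
  have h3 : ∀ᶠ q : E × E in 𝓝 (a, a), τ q.2 + T (q.1 - q.2) ∈ ball (τ a) s := by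
    have : ContinuousAt (fun q : E × E ↦ τ q.2 + T (q.1 - q.2)) (a, a) :=
      (hτ.continuousAt.comp (x := (a, a)) continuousAt_snd).add
        (T.continuous.comp (continuous_fst.sub continuous_snd)).continuousAt
    exact this.preimage_mem_nhds (by simpa using ball_mem_nhds (τ a) hspos)
  rw [nhds_prod_eq] at h1 h2 h2' h3
  obtain ⟨V, hV, hV'⟩ := eventually_prod_self_iff'.1 (h1.and (h2.and (h2'.and h3)))
  obtain ⟨r', hr', hV⟩ := Metric.mem_nhds_iff.1 hV
  refine ⟨c * m / 2, by positivity, r', hr', fun v ↦ ?_⟩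
  -- The displacement of `τ` along `v` is nearly `T v` whatever the base point, so a single
  -- functional still serves all `y`.
  obtain ⟨l, hl, hl'⟩ := H (T v)
  refine ⟨l, hl, fun y hy hyv ↦ ?_⟩
  obtain ⟨h1, h2, h2', h3⟩ := hV' _ (hV hyv) _ (hV hy)
  simp only [add_sub_cancel_left] at h1 h2 h2' h3
  have hsr : ball (τ a) s ⊆ ball (τ a) r := ball_subset_ball (min_le_left _ _)
  have hsρ : ball (τ a) s ⊆ U := (ball_subset_ball (min_le_right _ _)).trans hρU
  have h4 := hl' (τ y) (hsr h2) (hsr h3)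
  have h5 : ‖g (τ (y + v)) - g (τ y + T v)‖ ≤ K * (ε * ‖v‖) := by
    have := hg.dist_le_mul _ (hsρ h2') _ (hsρ h3)
    rw [dist_eq_norm, dist_eq_norm] at this
    refine this.trans ?_
    gcongr
    rwa [← sub_sub]
  have h6 : l (g (τ y + T v) - g (τ (y + v))) ≤ K * (ε * ‖v‖) := by
    refine ((le_abs_self _).trans (l.le_of_opNorm_le hl _)).trans ?_
    rwa [one_mul, norm_sub_rev]
  have h7 : l ((g ∘ τ) (y + v) - (g ∘ τ) y) =
      l (g (τ y + T v) - g (τ y)) - l (g (τ y + T v) - g (τ (y + v))) := by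
    simp only [Function.comp_apply, map_sub]; ring
  rw [h7]
  have h8 : K * ε ≤ c * m / 2 := by
    rw [hε, mul_div_assoc', div_le_div_iff₀ (by positivity) (by positivity)]
    nlinarith [mul_pos hc hm, K.2]
  have h9 : c * (m * ‖v‖) ≤ c * ‖T v‖ := by gcongr; exact hmT v
  nlinarith [norm_nonneg v, mul_le_mul_of_nonneg_right h8 (norm_nonneg v)]

/-- Invariance under a change of coordinates in the target. -/
theorem ConvexlyExpandingAt.comp_left {g : E → E'} {a : E} {σ : E' → E'} {T : E' ≃L[ℝ] E'}
    (h : ConvexlyExpandingAt g a) {K : ℝ≥0} {U : Set E} (hU : U ∈ 𝓝 a)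
    (hg : LipschitzOnWith K g U) (hσ : HasStrictFDerivAt σ (T : E' →L[ℝ] E') (g a)) :
    ConvexlyExpandingAt (σ ∘ g) a := by
  obtain ⟨c, hc, r, hr, H⟩ := h
  set m := ‖(T.symm : E' →L[ℝ] E')‖ + 1 with hm
  have hmpos : 0 < m := by positivity
  set ε := c / (2 * m * (K + 1)) with hε
  have hεpos : 0 < ε := by positivity
  have h1 : ∀ᶠ q : E' × E' in 𝓝 (g a, g a),
      ‖σ q.1 - σ q.2 - T (q.1 - q.2)‖ ≤ ε * ‖q.1 - q.2‖ :=
    (hasStrictFDerivAt_iff_isLittleO.1 hσ).def hεpos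
  rw [nhds_prod_eq] at h1
  obtain ⟨V, hV, hV'⟩ := eventually_prod_self_iff'.1 h1
  have hgc : ContinuousAt g a := hg.continuousOn.continuousAt hU
  obtain ⟨r', hr', hV⟩ := Metric.mem_nhds_iff.1 (inter_mem (hgc.preimage_mem_nhds hV) hU)
  refine ⟨c / (2 * m), by positivity, min r r', lt_min hr hr', fun v ↦ ?_⟩
  obtain ⟨l, hl, hl'⟩ := H v
  have hlT : ‖l ∘L (T.symm : E' →L[ℝ] E')‖ ≤ m := by
    refine (l.opNorm_comp_le _).trans ?_
    have := norm_nonneg (T.symm : E' →L[ℝ] E')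
    nlinarith
  -- The functional is carried to the new coordinates by `T⁻¹`; the factor `m⁻¹` restores norm at
  -- most `1`.
  refine ⟨m⁻¹ • (l ∘L (T.symm : E' →L[ℝ] E')), ?_, fun y hy hyv ↦ ?_⟩
  · rw [norm_smul, norm_inv, Real.norm_of_nonneg hmpos.le, inv_mul_le_iff₀ hmpos, mul_one]
    exact hlT
  have hy' := hV (ball_subset_ball (min_le_right _ _) hy)
  have hyv' := hV (ball_subset_ball (min_le_right _ _) hyv)
  have h2 := hl' y (ball_subset_ball (min_le_left _ _) hy) (ball_subset_ball (min_le_left _ _) hyv)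
  have h3 := hV' _ hyv'.1 _ hy'.1
  have h4 : ‖g (y + v) - g y‖ ≤ K * ‖v‖ := by
    simpa [dist_eq_norm] using hg.dist_le_mul _ hyv'.2 _ hy'.2
  set e := σ (g (y + v)) - σ (g y) - T (g (y + v) - g y) with he
  have h5 : σ (g (y + v)) - σ (g y) = T (g (y + v) - g y) + e := by rw [he]; abel
  have h6 : -(m * (ε * (K * ‖v‖))) ≤ l (T.symm e) := by
    have h7 : ‖(l ∘L (T.symm : E' →L[ℝ] E')) e‖ ≤ m * (ε * (K * ‖v‖)) := by
      refine ((l ∘L (T.symm : E' →L[ℝ] E')).le_of_opNorm_le hlT e).trans ?_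
      gcongr
      exact h3.trans (by gcongr)
    exact (abs_le.1 h7).1
  simp only [Function.comp_apply, h5, _root_.smul_apply,
    ContinuousLinearMap.comp_apply, ContinuousLinearEquiv.coe_coe, map_add,
    ContinuousLinearEquiv.symm_apply_apply, smul_eq_mul]
  rw [← mul_add, ← div_eq_inv_mul, ← div_div, div_mul_eq_mul_div (c / 2) m]
  refine div_le_div_of_nonneg_right ?_ hmpos.le
  have h8 : m * (ε * K) ≤ c / 2 := by
    have : m * (ε * K) = c / 2 * (K / (K + 1)) := by rw [hε]; field_simp
    rw [this]
    refine mul_le_of_le_one_right (by positivity) ?_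
    rw [div_le_one (by positivity)]
    linarith
  nlinarith [mul_le_mul_of_nonneg_right h8 (norm_nonneg v)]

end Expanding

/-! ### From Clarke's generalized differential to convex expansion. -/

section Clarke

variable {E : Type*} [NormedAddCommGroup E] [NormedSpace ℝ E] [FiniteDimensional ℝ E]

theorem Function.Embedding.sum_extend_zero {ι κ V : Type*} [Fintype ι] [Fintype κ]
    [AddCommMonoid V] (e : ι ↪ κ) (f : ι → V) :
    ∑ j, Function.extend e f 0 j = ∑ i, f i := by
  rw [← Finset.sum_subset (Finset.subset_univ (Finset.univ.map e)), Finset.sum_map]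
  · exact Finset.sum_congr rfl fun i _ ↦ e.injective.extend_apply f 0 i
  · intro j _ hj
    rw [Function.extend_apply']
    · rfl
    · rintro ⟨i, rfl⟩
      exact hj (Finset.mem_map_of_mem e (Finset.mem_univ i))

/-- In a finite-dimensional space the convex hull of a compact set is compact. -/
theorem IsCompact.convexHull_of_finiteDimensional {s : Set E} (hs : IsCompact s) :
    IsCompact (convexHull ℝ s) := by
  rcases s.eq_empty_or_nonempty with rfl | ⟨x₀, hx₀⟩
  · simp
  -- By Carathéodory, `d` points suffice for every convex combination, so the hull is the continuous
  -- image of a simplex times `s ^ d`. Shorter combinations are padded with weight `0` at the point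
  -- `x₀`.
  set d := Module.finrank ℝ E + 1
  let Φ : (Fin d → ℝ) × (Fin d → E) → E := fun q ↦ ∑ i, q.1 i • q.2 i
  have hΦ : Continuous Φ := by fun_prop
  have hK : IsCompact ((stdSimplex ℝ (Fin d)) ×ˢ (univ.pi fun _ : Fin d ↦ s)) :=
    (isCompact_stdSimplex ℝ (Fin d)).prod (isCompact_univ_pi fun _ ↦ hs)
  convert hK.image hΦ using 1
  apply Subset.antisymm
  · intro x hx
    obtain ⟨ι, hι, z, w, hz, hai, hw, hw1, rfl⟩ := eq_pos_convex_span_of_mem_convexHull hx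
    have hcard : Fintype.card ι ≤ Fintype.card (Fin d) := by
      rw [Fintype.card_fin]
      exact hai.card_le_finrank_succ.trans
        (Nat.succ_le_succ (Submodule.finrank_le _))
    obtain ⟨e⟩ := Function.Embedding.nonempty_of_card_le hcard
    refine ⟨(Function.extend e w 0, Function.extend e z fun _ ↦ x₀), ⟨⟨fun j ↦ ?_, ?_⟩, ?_⟩, ?_⟩
    · by_cases hj : ∃ i, e i = j
      · obtain ⟨i, rfl⟩ := hj
        simpa only [e.injective.extend_apply] using (hw i).le
      · simp only [Function.extend_apply' _ _ _ hj]
        exact le_rfl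
    · exact (e.sum_extend_zero w).trans hw1
    · intro j _
      by_cases hj : ∃ i, e i = j
      · obtain ⟨i, rfl⟩ := hj
        simp only [e.injective.extend_apply]
        exact hz (mem_range_self i)
      · simpa only [Function.extend_apply' _ _ _ hj] using hx₀
    · rw [← e.sum_extend_zero]
      refine Finset.sum_congr rfl fun j _ ↦ ?_
      by_cases hj : ∃ i, e i = j
      · obtain ⟨i, rfl⟩ := hj
        simp only [e.injective.extend_apply]
      · simp [Function.extend_apply' _ _ _ hj]
  · rintro _ ⟨⟨w, z⟩, ⟨hw, hz⟩, rfl⟩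
    exact (convex_convexHull ℝ s).sum_mem (fun i _ ↦ hw.1 i) hw.2
      fun i _ ↦ subset_convexHull ℝ s (hz i (mem_univ i))

/-- An almost everywhere lower bound for the derivative of a Lipschitz function is a lower bound for its increments. -/
theorem LipschitzWith.le_sub_of_ae_le_fderiv [MeasurableSpace E] [BorelSpace E]
    (ν : Measure E) [ν.IsAddHaarMeasure] {h : E → ℝ} {K : ℝ≥0} (hh : LipschitzWith K h)
    {a : E} {r c : ℝ} {v : E}
    (hc : ∀ᵐ y ∂ν, y ∈ ball a r → c ≤ fderiv ℝ h y v)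
    {y : E} (hy : y ∈ ball a r) (hyv : y + v ∈ ball a r) : c ≤ h (y + v) - h y := by
  -- The segment from `y` to `y + v` may consist of points where `h` is not differentiable.
  -- Averaging over small translates avoids this: the exceptional set is null for the absolutely
  -- continuous measure `μ`, so the averaged function has derivative at least `c` along the segment.
  -- Its endpoint values differ from those of `h` by at most `K * ε` each.
  have key : ∀ᶠ ε in 𝓝[>] (0 : ℝ), c ≤ h (y + v) - h y + 2 * K * ε := by
    have h1 : ∀ᶠ ε in 𝓝 (0 : ℝ), ε < r - dist y a := gt_mem_nhds (sub_pos.2 hy)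
    have h2 : ∀ᶠ ε in 𝓝 (0 : ℝ), ε < r - dist (y + v) a := gt_mem_nhds (sub_pos.2 hyv)
    filter_upwards [self_mem_nhdsWithin, nhdsWithin_le_nhds h1, nhdsWithin_le_nhds h2]
      with ε hε hε1 hε2
    obtain ⟨μ, hμ, hac, hsupp, hμg⟩ := exists_mollifier (E' := ℝ) ν hε
    have hint := (hμg hh.continuous.locallyIntegrable).1
    have hnear : ∀ z, |∫ w, h (z - w) ∂μ - h z| ≤ K * ε := by
      intro z
      have : ∫ w, h (z - w) ∂μ ∈ closedBall (h z) (K * ε) := by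
        refine (convex_closedBall _ _).integral_mem isClosed_closedBall ?_ (hint z)
        filter_upwards [hsupp] with w hw
        refine mem_closedBall.2 ((hh.dist_le_mul _ _).trans ?_)
        gcongr
        simpa [dist_eq_norm] using (mem_ball_zero_iff.1 hw).le
      simpa [Real.dist_eq] using this
    have hshift : ∀ {P : E → Prop}, (∀ᵐ y ∂ν, P y) → ∀ z, ∀ᵐ w ∂μ, P (z - w) := fun hP z ↦
      hac.ae_le ((quasiMeasurePreserving_sub_left ν z).ae hP)
    have hder : ∀ t : ℝ, HasDerivAt (fun t : ℝ ↦ ∫ w, h (y + t • v - w) ∂μ)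
        (∫ w, fderiv ℝ h (y + t • v - w) v ∂μ) t := by
      intro t
      refine (hasDerivAt_integral_of_dominated_loc_of_lip (s := univ) (bound := fun _ ↦ K * ‖v‖)
        univ_mem ?_ (hint _) ?_ ?_ (integrable_const _) ?_).2
      · exact Eventually.of_forall fun t ↦ (hint _).aestronglyMeasurable
      · exact ((measurable_fderiv_apply_const ℝ h v).comp
          (measurable_const.sub measurable_id)).aestronglyMeasurable
      · refine Eventually.of_forall fun w ↦ LipschitzOnWith.of_dist_le_mul fun s _ s' _ ↦ ?_
        refine (hh.dist_le_mul _ _).trans_eq ?_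
        rw [dist_eq_norm, dist_eq_norm, Real.coe_nnabs, abs_of_nonneg (by positivity)]
        have : y + s • v - w - (y + s' • v - w) = (s - s') • v := by module
        rw [this, norm_smul]
        ring
      · filter_upwards [hshift hh.ae_differentiableAt (y + t • v)] with w hw
        have h1 : HasDerivAt (fun t : ℝ ↦ y + t • v - w) v t := by
          simpa using (((hasDerivAt_id t).smul_const v).const_add y).sub_const w
        exact hw.hasFDerivAt.comp_hasDerivAt t h1
    have hseg : ∀ t ∈ Icc (0 : ℝ) 1, ∀ w ∈ ball (0 : E) ε, y + t • v - w ∈ ball a r := by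
      intro t ht w hw
      have h3 : y + t • v ∈ ball a (r - ε) := by
        refine (convex_ball a (r - ε)).segment_subset (x := y) (y := y + v)
          (mem_ball.2 (by linarith)) (mem_ball.2 (by linarith)) ?_
        rw [segment_eq_image']
        exact ⟨t, ht, by simp⟩
      have h4 : dist (y + t • v - w) (y + t • v) < ε := by
        simpa [dist_eq_norm] using mem_ball_zero_iff.1 hw
      have := dist_triangle (y + t • v - w) (y + t • v) a
      exact mem_ball.2 (by linarith [mem_ball.1 h3])
    have hmv := (convex_Icc (0 : ℝ) 1).mul_sub_le_image_sub_of_le_deriv (C := c)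
      (f := fun t : ℝ ↦ ∫ w, h (y + t • v - w) ∂μ)
      (fun t _ ↦ (hder t).continuousAt.continuousWithinAt)
      (fun t _ ↦ (hder t).differentiableAt.differentiableWithinAt) (fun t ht ↦ by
        rw [(hder t).deriv]
        have hi : Integrable (fun w ↦ fderiv ℝ h (y + t • v - w) v) μ := by
          refine Integrable.of_bound ((measurable_fderiv_apply_const ℝ h v).comp
            (measurable_const.sub measurable_id)).aestronglyMeasurable (K * ‖v‖)
            (Eventually.of_forall fun w ↦ ?_)
          exact (fderiv ℝ h _).le_of_opNorm_le (norm_fderiv_le_of_lipschitz ℝ hh) v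
        refine (convex_Ici c).integral_mem isClosed_Ici ?_ hi
        filter_upwards [hsupp, hshift hc (y + t • v)] with w hw hw'
        exact hw' (hseg t (interior_subset ht) w hw)) 0 (by simp) 1 (by simp) zero_le_one
    simp only [one_smul, zero_smul, add_zero, sub_zero, mul_one] at hmv
    have h5 := abs_le.1 (hnear y)
    have h6 := abs_le.1 (hnear (y + v))
    linarith
  have hlim : Tendsto (fun ε : ℝ ↦ h (y + v) - h y + 2 * K * ε) (𝓝[>] 0)
      (𝓝 (h (y + v) - h y + 2 * K * 0)) :=
    (Continuous.tendsto (by fun_prop) _).mono_left nhdsWithin_le_nhds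
  simpa using ge_of_tendsto hlim key

variable {E' : Type*} [NormedAddCommGroup E'] [InnerProductSpace ℝ E']

/-- A convex set of vectors of norm at least `c` lies in a half-space at distance `c` from the
origin. -/
theorem Convex.exists_le_of_forall_le_norm {s : Set E'} (hs : Convex ℝ s) (hsc : IsCompact s)
    {c : ℝ} (hc : ∀ w ∈ s, c ≤ ‖w‖) : ∃ l : E' →L[ℝ] ℝ, ‖l‖ ≤ 1 ∧ ∀ w ∈ s, c ≤ l w := by
  rcases s.eq_empty_or_nonempty with rfl | hne
  · exact ⟨0, by simp, by simp⟩
  -- The point of `s` nearest to the origin gives the normal direction; `s` lies beyond the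
  -- hyperplane through `w₀` orthogonal to it.
  obtain ⟨w₀, hw₀, hmin⟩ := exists_norm_eq_iInf_of_complete_convex hne hsc.isComplete hs 0
  have hproj := (norm_eq_iInf_iff_real_inner_le_zero hs hw₀).1 hmin
  rcases eq_or_ne w₀ 0 with h0 | h0
  · have : c ≤ 0 := by simpa [h0] using hc w₀ hw₀
    exact ⟨0, by simp, fun w _ ↦ by simpa using this⟩
  have hn : 0 < ‖w₀‖ := norm_pos_iff.2 h0
  refine ⟨‖w₀‖⁻¹ • innerSL ℝ w₀, ?_, fun w hw ↦ ?_⟩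
  · rw [norm_smul, innerSL_apply_norm, norm_inv, norm_norm, inv_mul_cancel₀ hn.ne']
  · have h1 := hproj w hw
    simp only [zero_sub, inner_neg_left, inner_sub_right, real_inner_self_eq_norm_sq] at h1
    have h2 : ‖w₀‖ ≤ ‖w₀‖⁻¹ * inner ℝ w₀ w := by
      rw [le_inv_mul_iff₀ hn]; nlinarith
    simpa using (hc w₀ hw₀).trans h2

/-- If all elements of Clarke's generalized differential of `g` at `a` are injective, then `g` is
convexly expanding at `a`. -/
theorem convexlyExpandingAt_of_injective [FiniteDimensional ℝ E'] {g : E → E'} {a : E} {R : ℝ} (hR : 0 < R) {K : ℝ≥0}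
    (hg : LipschitzOnWith K g (ball a R))
    (hinj : ∀ A ∈ convexHull ℝ {A : E →L[ℝ] E' | ∃ u : ℕ → E, Tendsto u atTop (𝓝 a) ∧
      (∀ i, DifferentiableAt ℝ g (u i)) ∧ Tendsto (fun i ↦ fderiv ℝ g (u i)) atTop (𝓝 A)},
      Function.Injective A) : ConvexlyExpandingAt g a := by
  set D := {A : E →L[ℝ] E' | ∃ u : ℕ → E, Tendsto u atTop (𝓝 a) ∧
      (∀ i, DifferentiableAt ℝ g (u i)) ∧ Tendsto (fun i ↦ fderiv ℝ g (u i)) atTop (𝓝 A)} with hD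
  have hbound : ∀ y ∈ ball a R, ‖fderiv ℝ g y‖ ≤ K := fun y hy ↦
    norm_fderiv_le_of_lipschitzOn ℝ (isOpen_ball.mem_nhds hy) hg
  have hDb : D ⊆ closedBall 0 K := by
    rintro A ⟨u, hu, hd, hA⟩
    rw [mem_closedBall_zero_iff]
    refine le_of_tendsto hA.norm ?_
    filter_upwards [hu.eventually (ball_mem_nhds a hR)] with i hi using hbound _ hi
  have hcl : IsCompact (closure D) :=
    (isCompact_closedBall (0 : E →L[ℝ] E') K).of_isClosed_subset isClosed_closure
      (closure_minimal hDb isClosed_closedBall)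
  -- A diagonal choice: a limit of limits of differentials is again a limit of differentials at
  -- points tending to `a`.
  have hDcl : IsClosed D := by
    refine isClosed_of_closure_subset fun A hA ↦ ?_
    have : ∀ n : ℕ, ∃ y, dist y a < 1 / ((n : ℝ) + 1) ∧ DifferentiableAt ℝ g y ∧
        dist (fderiv ℝ g y) A < 2 * (1 / ((n : ℝ) + 1)) := by
      intro n
      have hn : (0 : ℝ) < 1 / ((n : ℝ) + 1) := by positivity
      obtain ⟨B, ⟨u, hu, hd, hB⟩, hAB⟩ := Metric.mem_closure_iff.1 hA _ hn
      obtain ⟨i, h1, h2⟩ := ((hu.eventually (ball_mem_nhds a hn)).and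
        (hB.eventually (ball_mem_nhds B hn))).exists
      refine ⟨u i, h1, hd i, ?_⟩
      have := dist_triangle (fderiv ℝ g (u i)) B A
      have h3 := mem_ball.1 h2
      rw [dist_comm B A] at this
      linarith
    choose u hu1 hu2 hu3 using this
    refine ⟨u, tendsto_iff_dist_tendsto_zero.2 ?_, hu2, tendsto_iff_dist_tendsto_zero.2 ?_⟩
    · exact squeeze_zero (fun _ ↦ dist_nonneg) (fun n ↦ (hu1 n).le)
        tendsto_one_div_add_atTop_nhds_zero_nat
    · refine squeeze_zero (fun _ ↦ dist_nonneg) (fun n ↦ (hu3 n).le) ?_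
      simpa using (tendsto_one_div_add_atTop_nhds_zero_nat (𝕜 := ℝ)).const_mul 2
  have hDc : IsCompact D := hDcl.closure_eq ▸ hcl
  have hC := hDc.convexHull_of_finiteDimensional
  set C := convexHull ℝ D with hCdef
  -- `‖A v‖` is positive on the compact product of `C` and the unit sphere, hence bounded below
  -- there.
  obtain ⟨c, hc, hcC⟩ : ∃ c > 0, ∀ A ∈ C, ∀ v : E, c * ‖v‖ ≤ ‖A v‖ := by
    have hcont : Continuous fun q : (E →L[ℝ] E') × E ↦ ‖q.1 q.2‖ := by fun_prop
    obtain ⟨c, hc, h⟩ := (hC.prod (isCompact_sphere (0 : E) 1)).exists_forall_le' (a := 0)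
      hcont.continuousOn (by
        rintro ⟨A, v⟩ ⟨hA, hv⟩
        have hv0 : v ≠ 0 := ne_of_mem_sphere hv one_ne_zero
        exact norm_pos_iff.2 fun h ↦ hv0 (hinj A hA (h.trans (map_zero A).symm)))
    refine ⟨c, hc, fun A hA v ↦ ?_⟩
    rcases eq_or_ne v 0 with rfl | hv
    · simp
    have hn : 0 < ‖v‖ := norm_pos_iff.2 hv
    have := h (A, ‖v‖⁻¹ • v) ⟨hA, by simp [norm_smul, hn.ne']⟩
    simp only [map_smul, norm_smul, norm_inv, norm_norm] at this
    rwa [le_inv_mul_iff₀ hn, mul_comm] at this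
  -- Otherwise differentials at points tending to `a` would stay away from `C`; being bounded they
  -- subconverge, and the limit lies in `D ⊆ C`.
  obtain ⟨r, hr, hrD⟩ : ∃ r > 0, ∀ y ∈ ball a r, DifferentiableAt ℝ g y →
      ∃ A ∈ C, ‖fderiv ℝ g y - A‖ < c / 2 := by
    by_contra! hcon
    have : ∀ n : ℕ, ∃ y ∈ ball a (1 / ((n : ℝ) + 1)), DifferentiableAt ℝ g y ∧
      ∀ A ∈ C, c / 2 ≤ ‖fderiv ℝ g y - A‖ := fun n ↦ hcon _ (by positivity)
    choose u hu1 hu2 hu3 using this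
    have hu : Tendsto u atTop (𝓝 a) := tendsto_iff_dist_tendsto_zero.2
      (squeeze_zero (fun _ ↦ dist_nonneg) (fun n ↦ (mem_ball.1 (hu1 n)).le)
        tendsto_one_div_add_atTop_nhds_zero_nat)
    have hfr : ∃ᶠ n in atTop, fderiv ℝ g (u n) ∈ closedBall (0 : E →L[ℝ] E') K := by
      apply Eventually.frequently
      filter_upwards [hu.eventually (ball_mem_nhds a hR)] with i hi
      exact mem_closedBall_zero_iff.2 (hbound _ hi)
    obtain ⟨A, -, φ, hφ, hA⟩ :=
      (isCompact_closedBall (0 : E →L[ℝ] E') K).tendsto_subseq' hfr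
    have hAC : A ∈ C := subset_convexHull ℝ D
      ⟨u ∘ φ, hu.comp hφ.tendsto_atTop, fun i ↦ hu2 _, hA⟩
    obtain ⟨i, hi⟩ := (hA.eventually (ball_mem_nhds A (half_pos hc))).exists
    have := hu3 (φ i) A hAC
    rw [dist_eq_norm] at hi
    exact absurd hi (not_lt.2 this)
  refine ⟨c / 2, half_pos hc, min r R, lt_min hr hR, fun v ↦ ?_⟩
  have hev : Continuous fun A : E →L[ℝ] E' ↦ A v := by fun_prop
  obtain ⟨l, hl, hlv⟩ := ((convex_convexHull ℝ D).is_linear_image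
    (f := fun A : E →L[ℝ] E' ↦ A v) ⟨fun _ _ ↦ rfl, fun _ _ ↦ rfl⟩).exists_le_of_forall_le_norm
    (hC.image hev) (c := c * ‖v‖) (by rintro _ ⟨A, hA, rfl⟩; exact hcC A hA v)
  refine ⟨l, hl, fun y hy hyv ↦ ?_⟩
  have hlg : LipschitzOnWith (‖l‖₊ * K) (l ∘ g) (ball a (min r R)) :=
    l.lipschitz.comp_lipschitzOnWith (hg.mono (ball_subset_ball (min_le_right _ _)))
  -- The mean value inequality is stated for globally Lipschitz functions; the extension agrees with
  -- `l ∘ g` on the ball, hence has the same derivatives there.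
  obtain ⟨h, hh, hhg⟩ := hlg.extend_real
  borelize E
  have hmain := hh.le_sub_of_ae_le_fderiv (Measure.addHaar : Measure E) (a := a) (r := min r R)
    (c := c / 2 * ‖v‖) (v := v) ?_ hy hyv
  · rw [map_sub]
    rw [← hhg hy, ← hhg hyv] at hmain
    exact hmain
  · filter_upwards [hg.ae_differentiableWithinAt_of_mem] with z hz hzr
    have hzR : z ∈ ball a R := ball_subset_ball (min_le_right _ _) hzr
    have hgz : DifferentiableAt ℝ g z := (hz hzR).differentiableAt (isOpen_ball.mem_nhds hzR)
    have hhz : HasFDerivAt h (l ∘L fderiv ℝ g z) z :=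
      (l.hasFDerivAt.comp z hgz.hasFDerivAt).congr_of_eventuallyEq
        ((hhg.symm).eventuallyEq_of_mem (isOpen_ball.mem_nhds hzr))
    obtain ⟨A, hA, hAz⟩ := hrD z (ball_subset_ball (min_le_left _ _) hzr) hgz
    rw [hhz.fderiv]
    have h1 := hlv (A v) ⟨A, hA, rfl⟩
    have h2 : |l ((fderiv ℝ g z - A) v)| ≤ 1 * (c / 2 * ‖v‖) :=
      l.le_of_opNorm_le_of_le hl ((fderiv ℝ g z - A).le_of_opNorm_le hAz.le v)
    have h3 := (abs_le.1 h2).1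
    simp only [_root_.sub_apply, map_sub] at h3
    simp only [ContinuousLinearMap.comp_apply]
    linarith

end Clarke

/-! ### Changes of coordinates and velocities of curves in charts. -/

section CoordChange

variable {E : Type*} [NormedAddCommGroup E] [NormedSpace ℝ E]
  {M : Type*} [TopologicalSpace M] [ChartedSpace E M] [IsManifold 𝓘(ℝ, E) ∞ M]

/-- Changes of coordinates are strictly differentiable, with invertible derivative. -/
theorem exists_hasStrictFDerivAt_coordChange {x₀ x₁ p : M}
    (h₀ : p ∈ (extChartAt 𝓘(ℝ, E) x₀).source) (h₁ : p ∈ (extChartAt 𝓘(ℝ, E) x₁).source) :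
    ∃ T : E ≃L[ℝ] E, HasStrictFDerivAt (extChartAt 𝓘(ℝ, E) x₁ ∘ (extChartAt 𝓘(ℝ, E) x₀).symm)
      (T : E →L[ℝ] E) (extChartAt 𝓘(ℝ, E) x₀ p) := by
  have hc : ContDiffAt ℝ ∞ (extChartAt 𝓘(ℝ, E) x₁ ∘ (extChartAt 𝓘(ℝ, E) x₀).symm)
      (extChartAt 𝓘(ℝ, E) x₀ p) := by
    have := contDiffWithinAt_ext_coord_change (I := 𝓘(ℝ, E)) (n := ∞) x₁ x₀
      (y := extChartAt 𝓘(ℝ, E) x₀ p) (by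
        rw [ext_coord_change_source]
        rw [extChartAt_source] at h₀ h₁
        exact ⟨chartAt E x₀ p, by simp [h₀, h₁], rfl⟩)
    simpa [contDiffWithinAt_univ] using this
  refine ⟨ContinuousLinearEquiv.equivOfInverse (tangentCoordChange 𝓘(ℝ, E) x₀ x₁ p)
    (tangentCoordChange 𝓘(ℝ, E) x₁ x₀ p) (fun v ↦ ?_) (fun v ↦ ?_), ?_⟩
  · rw [tangentCoordChange_comp ⟨⟨h₀, h₁⟩, h₀⟩, tangentCoordChange_self h₀]
  · rw [tangentCoordChange_comp ⟨⟨h₁, h₀⟩, h₁⟩, tangentCoordChange_self h₁]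
  · convert hc.hasStrictFDerivAt (by simp) using 1
    ext v
    simp [fderivWithin_univ]

theorem hasDerivWithinAt_extChartAt_comp {p : M} {γ : ℝ → M} {s : Set ℝ} {t : ℝ}
    (hγ : MDifferentiableWithinAt 𝓘(ℝ, ℝ) 𝓘(ℝ, E) γ s t)
    (ht : γ t ∈ (extChartAt 𝓘(ℝ, E) p).source) :
    HasDerivWithinAt (extChartAt 𝓘(ℝ, E) p ∘ γ)
      ((trivializationAt E (TangentSpace 𝓘(ℝ, E) : M → Type _) p).continuousLinearMapAt ℝ (γ t)
        (mfderivWithin 𝓘(ℝ, ℝ) 𝓘(ℝ, E) γ s t 1)) s t := by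
  have ht' : γ t ∈ (chartAt E p).source := by simpa using ht
  have h1 := (mdifferentiableAt_extChartAt (I := 𝓘(ℝ, E)) ht').hasMFDerivAt
  have h2 := h1.comp_hasMFDerivWithinAt t hγ.hasMFDerivWithinAt
  rw [TangentBundle.continuousLinearMapAt_trivializationAt ht']
  have h3 : HasFDerivWithinAt (extChartAt 𝓘(ℝ, E) p ∘ γ)
      ((show E →L[ℝ] E from mfderiv 𝓘(ℝ, E) 𝓘(ℝ, E) (extChartAt 𝓘(ℝ, E) p) (γ t)) ∘L
        (show ℝ →L[ℝ] E from mfderivWithin 𝓘(ℝ, ℝ) 𝓘(ℝ, E) γ s t)) s t := h2.hasFDerivWithinAt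
  exact h3.hasDerivWithinAt

end CoordChange

/-! ### Riemannian distance: local-to-global Lipschitz bounds and comparison with a norm. -/

section Riemannian

variable {E : Type*} [NormedAddCommGroup E] [NormedSpace ℝ E]
  {M : Type*} [EMetricSpace M] [ChartedSpace E M]
  [RiemannianBundle (fun x : M ↦ TangentSpace 𝓘(ℝ, E) x)]

/-- On a Riemannian manifold a locally `K`-Lipschitz map does not increase the extended distance
by more than the factor `K`, even globally. -/
theorem edist_le_of_locally_lipschitz [IsRiemannianManifold 𝓘(ℝ, E) M] {Y : Type*}
    [PseudoEMetricSpace Y] {G : M → Y} {K : ℝ≥0} (hK : 0 < K)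
    (hG : ∀ p, ∃ U ∈ 𝓝 p, LipschitzOnWith K G U) (x y : M) :
    edist (G x) (G y) ≤ K * edist x y := by
  by_contra! hlt
  have hK0 : (K : ℝ≥0∞) ≠ 0 := by exact_mod_cast hK.ne'
  obtain ⟨s, hs, hsX⟩ := exists_between
    ((ENNReal.lt_div_iff_mul_lt (Or.inl hK0) (Or.inl ENNReal.coe_ne_top)).2
      (by rwa [mul_comm] at hlt))
  rw [ENNReal.lt_div_iff_mul_lt (Or.inl hK0) (Or.inl ENNReal.coe_ne_top)] at hsX
  rw [IsRiemannianManifold.out (I := 𝓘(ℝ, E)) x y] at hs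
  obtain ⟨γ, rfl, rfl, hγ, hγs, -⟩ :=
    Manifold.exists_lt_locally_constant_of_riemannianEDist_lt hs zero_lt_one
  -- An almost shortest path is cut into pieces whose endpoints lie in a common `U p`; the local
  -- bounds then add up along the path.
  choose U hU hUG using hG
  obtain ⟨t, ht0, htm, ⟨n, hn⟩, ht⟩ := exists_monotone_Icc_subset_open_cover_Icc
    (zero_le_one (α := ℝ)) (c := fun p ↦ (fun t : Icc (0 : ℝ) 1 ↦ γ t) ⁻¹' interior (U p))
    (fun p ↦ isOpen_interior.preimage (hγ.continuous.comp continuous_subtype_val))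
    (fun t _ ↦ mem_iUnion.2 ⟨γ t, mem_interior_iff_mem_nhds.2 (hU _)⟩)
  have hind : ∀ k, edist (G (γ 0)) (G (γ (t k))) ≤ K * pathELength 𝓘(ℝ, E) γ 0 (t k) := by
    intro k
    induction k with
    | zero => simp [ht0]
    | succ k ih =>
      obtain ⟨p, hp⟩ := ht k
      have hle : t k ≤ t (k + 1) := htm (Nat.le_succ k)
      have h1 := hUG p (interior_subset (hp ⟨le_rfl, hle⟩)) (interior_subset (hp ⟨hle, le_rfl⟩))
      have h2 : edist (γ (t k)) (γ (t (k + 1))) ≤ pathELength 𝓘(ℝ, E) γ (t k) (t (k + 1)) := by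
        rw [IsRiemannianManifold.out (I := 𝓘(ℝ, E))]
        exact riemannianEDist_le_pathELength hγ.contMDiffOn rfl rfl hle
      calc edist (G (γ 0)) (G (γ (t (k + 1))))
          ≤ edist (G (γ 0)) (G (γ (t k))) + edist (G (γ (t k))) (G (γ (t (k + 1)))) :=
            edist_triangle _ _ _
        _ ≤ K * pathELength 𝓘(ℝ, E) γ 0 (t k) + K * pathELength 𝓘(ℝ, E) γ (t k) (t (k + 1)) :=
            add_le_add ih (h1.trans (by gcongr))
        _ = K * pathELength 𝓘(ℝ, E) γ 0 (t (k + 1)) := by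
            rw [← mul_add, pathELength_add (t k).2.1 hle]
  have h1 := hind n
  rw [hn n le_rfl] at h1
  refine absurd (h1.trans_lt ?_) (lt_irrefl _)
  calc (K : ℝ≥0∞) * pathELength 𝓘(ℝ, E) γ 0 1 ≤ K * s := by gcongr
    _ < _ := by rwa [mul_comm]

variable [IsManifold 𝓘(ℝ, E) ∞ M] [IsContinuousRiemannianBundle E (fun x : M ↦ TangentSpace 𝓘(ℝ, E) x)]

/-- Continuity of the metric at `p`, read in the trivialization there; the next lemma is the reverse
comparison. -/
theorem eventually_enorm_symmL_le (p : M) {r : ℝ≥0} (hr : 1 < r) :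
    ∀ᶠ y in 𝓝 p, ∀ w : E,
      ‖(trivializationAt E (TangentSpace 𝓘(ℝ, E) : M → Type _) p).symmL ℝ y w‖ₑ ≤
        r * ‖(trivializationAt E (TangentSpace 𝓘(ℝ, E) : M → Type _) p).symmL ℝ p w‖ₑ := by
  filter_upwards [eventually_norm_symmL_trivializationAt_comp_self_lt E
    (TangentSpace 𝓘(ℝ, E) : M → Type _) p (r := r) (by exact_mod_cast hr)] with y hy w
  have h := ContinuousLinearMap.le_of_opNorm_le _ hy.le
    ((trivializationAt E (TangentSpace 𝓘(ℝ, E) : M → Type _) p).symmL ℝ p w)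
  rw [ContinuousLinearMap.comp_apply, Trivialization.continuousLinearMapAt_symmL _
    (FiberBundle.mem_baseSet_trivializationAt' p)] at h
  have h' := ENNReal.ofReal_le_ofReal h
  rwa [ENNReal.ofReal_mul r.coe_nonneg, ENNReal.ofReal_coe_nnreal, ofReal_norm, ofReal_norm] at h'

theorem eventually_enorm_continuousLinearMapAt_le (p : M) {r : ℝ≥0} (hr : 1 < r) :
    ∀ᶠ y in 𝓝 p, ∀ u : TangentSpace 𝓘(ℝ, E) y,
      ‖(trivializationAt E (TangentSpace 𝓘(ℝ, E) : M → Type _) p).symmL ℝ p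
        ((trivializationAt E (TangentSpace 𝓘(ℝ, E) : M → Type _) p).continuousLinearMapAt ℝ y u)‖ₑ
        ≤ r * ‖u‖ₑ := by
  filter_upwards [eventually_norm_symmL_trivializationAt_self_comp_lt E
    (TangentSpace 𝓘(ℝ, E) : M → Type _) p (r := r) (by exact_mod_cast hr)] with y hy u
  have h := ContinuousLinearMap.le_of_opNorm_le _ hy.le u
  rw [ContinuousLinearMap.comp_apply] at h
  have h' := ENNReal.ofReal_le_ofReal h
  rwa [ENNReal.ofReal_mul r.coe_nonneg, ENNReal.ofReal_coe_nnreal, ofReal_norm, ofReal_norm] at h'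

/-- The chart at `p`, composed with the identification of the model space with the tangent space
at `p`: near `p` it distorts distances by a factor arbitrarily close to `1`. -/
theorem eventually_edist_le_enorm_symmL [IsRiemannianManifold 𝓘(ℝ, E) M] (p : M) {r : ℝ≥0}
    (hr : 1 < r) :
    ∀ᶠ q : M × M in 𝓝 (p, p), edist q.1 q.2 ≤
      r * ‖(trivializationAt E (TangentSpace 𝓘(ℝ, E) : M → Type _) p).symmL ℝ p
        (extChartAt 𝓘(ℝ, E) p q.2 - extChartAt 𝓘(ℝ, E) p q.1)‖ₑ := by
  set φ := extChartAt 𝓘(ℝ, E) p with hφ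
  have h1 : ∀ᶠ w in 𝓝 (φ p), w ∈ φ.target ∧ ∀ u : E,
      ‖(trivializationAt E (TangentSpace 𝓘(ℝ, E) : M → Type _) p).symmL ℝ (φ.symm w) u‖ₑ ≤
        r * ‖(trivializationAt E (TangentSpace 𝓘(ℝ, E) : M → Type _) p).symmL ℝ p u‖ₑ := by
    have hc : Tendsto φ.symm (𝓝 (φ p)) (𝓝 p) := by
      have := continuousAt_extChartAt_symm (I := 𝓘(ℝ, E)) p
      rwa [ContinuousAt, extChartAt_to_inv] at this
    exact (eventually_mem_set.2 (extChartAt_target_mem_nhds p)).and (hc.eventually (eventually_enorm_symmL_le p hr))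
  obtain ⟨ρ, hρ, hball⟩ := Metric.eventually_nhds_iff_ball.1 h1
  have h2 : ∀ᶠ y in 𝓝 p, y ∈ φ.source ∧ φ y ∈ ball (φ p) ρ :=
    (eventually_mem_set.2 (extChartAt_source_mem_nhds p)).and
      ((continuousAt_extChartAt p).eventually (ball_mem_nhds _ hρ))
  rw [nhds_prod_eq]
  filter_upwards [h2.prod_mk h2] with q ⟨⟨hy, hyρ⟩, ⟨hz, hzρ⟩⟩
  set v := φ q.2 - φ q.1 with hv
  -- The straight segment in the chart is a competitor for the distance, of speed at most `r` times
  -- the norm of `v` at `p`.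
  let η : ℝ → E := fun t ↦ φ q.1 + t • v
  have hη : ∀ t ∈ Icc (0 : ℝ) 1, η t ∈ ball (φ p) ρ := fun t ht ↦
    (convex_ball (φ p) ρ).segment_subset hyρ hzρ (by
      rw [segment_eq_image']; exact ⟨t, ht, rfl⟩)
  have hηd : ContDiff ℝ 1 η := by fun_prop
  have hγ : ContMDiffOn 𝓘(ℝ, ℝ) 𝓘(ℝ, E) 1 (φ.symm ∘ η) (Icc 0 1) :=
    (contMDiffOn_extChartAt_symm p).comp hηd.contMDiff.contMDiffOn fun t ht ↦ (hball _ (hη t ht)).1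
  have h3 : edist q.1 q.2 ≤ pathELength 𝓘(ℝ, E) (φ.symm ∘ η) 0 1 := by
    rw [IsRiemannianManifold.out (I := 𝓘(ℝ, E))]
    refine riemannianEDist_le_pathELength hγ ?_ ?_ zero_le_one
    · simp [η, φ.left_inv hy]
    · simp [η, v, φ.left_inv hz]
  refine h3.trans ?_
  rw [pathELength_eq_lintegral_mfderivWithin_Icc]
  calc _ ≤ ∫⁻ t in Icc (0 : ℝ) 1,
        r * ‖(trivializationAt E (TangentSpace 𝓘(ℝ, E) : M → Type _) p).symmL ℝ p v‖ₑ := by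
        refine setLIntegral_mono' measurableSet_Icc fun t ht ↦ ?_
        have hU := uniqueDiffOn_Icc (zero_lt_one (α := ℝ)) t ht
        have hts : (φ.symm ∘ η) t ∈ φ.source := φ.map_target (hball _ (hη t ht)).1
        have hd := hasDerivWithinAt_extChartAt_comp (p := p)
          (hγ.mdifferentiableOn one_ne_zero t ht) hts
        have hd' : HasDerivWithinAt (φ ∘ φ.symm ∘ η) v (Icc 0 1) t := by
          have : HasDerivAt η v t := by
            simpa [η] using ((hasDerivAt_id t).smul_const v).const_add (φ q.1)
          exact this.hasDerivWithinAt.congr (fun s hs ↦ φ.right_inv (hball _ (hη s hs)).1)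
            (φ.right_inv (hball _ (hη t ht)).1)
        have heq := hU.eq_deriv _ hd hd'
        have hb : (φ.symm ∘ η) t ∈
            (trivializationAt E (TangentSpace 𝓘(ℝ, E) : M → Type _) p).baseSet := by
          rw [TangentBundle.trivializationAt_baseSet, ← extChartAt_source 𝓘(ℝ, E)]
          exact hts
        have h4 := Trivialization.symmL_continuousLinearMapAt
          (trivializationAt E (TangentSpace 𝓘(ℝ, E) : M → Type _) p) (R := ℝ) hb
          (mfderivWithin 𝓘(ℝ, ℝ) 𝓘(ℝ, E) (φ.symm ∘ η) (Icc 0 1) t 1)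
        rw [heq] at h4
        rw [← h4]
        exact (hball _ (hη t ht)).2 v
    _ = _ := by simp

/-- Here an almost shortest path is needed: it stays where the metric is close to its value at `p`,
and its displacement in the chart is at most the integral of its speed there. -/
theorem eventually_enorm_symmL_le_edist [IsRiemannianManifold 𝓘(ℝ, E) M] (p : M) {r : ℝ≥0}
    (hr : 1 < r) :
    ∀ᶠ q : M × M in 𝓝 (p, p),
      ‖(trivializationAt E (TangentSpace 𝓘(ℝ, E) : M → Type _) p).symmL ℝ p
        (extChartAt 𝓘(ℝ, E) p q.2 - extChartAt 𝓘(ℝ, E) p q.1)‖ₑ ≤ r * edist q.1 q.2 := by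
  set φ := extChartAt 𝓘(ℝ, E) p with hφ
  set T := (trivializationAt E (TangentSpace 𝓘(ℝ, E) : M → Type _) p).symmL ℝ p with hT
  obtain ⟨δ, hδ, hball⟩ := EMetric.mem_nhds_iff.1
    ((eventually_mem_set.2 (extChartAt_source_mem_nhds (I := 𝓘(ℝ, E)) p)).and
      (eventually_enorm_continuousLinearMapAt_le (E := E) p hr))
  -- Starting within `δ / 3` of `p` and having length below `2δ / 3`, the path cannot leave the ball
  -- of radius `δ`.
  have hδ3 : (0 : ℝ≥0∞) < δ / 3 := ENNReal.div_pos hδ.ne' (by simp)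
  have hr0 : (r : ℝ≥0∞) ≠ 0 := by exact_mod_cast (zero_lt_one.trans hr).ne'
  have h2 : ∀ᶠ y in 𝓝 p, edist y p < δ / 3 := Metric.eball_mem_nhds p hδ3
  rw [nhds_prod_eq]
  filter_upwards [h2.prod_mk h2] with q ⟨hy, hz⟩
  have hyz : edist q.1 q.2 < δ / 3 + δ / 3 :=
    (edist_triangle_right _ _ p).trans_lt (ENNReal.add_lt_add hy hz)
  by_contra! hlt
  obtain ⟨s, hs, hsm⟩ := exists_between (lt_min hyz
    ((ENNReal.lt_div_iff_mul_lt (Or.inl hr0) (Or.inl ENNReal.coe_ne_top)).2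
      (by rwa [mul_comm] at hlt)))
  obtain ⟨hsδ, hsX⟩ := lt_min_iff.1 hsm
  rw [ENNReal.lt_div_iff_mul_lt (Or.inl hr0) (Or.inl ENNReal.coe_ne_top)] at hsX
  rw [IsRiemannianManifold.out (I := 𝓘(ℝ, E))] at hs
  obtain ⟨γ, hγ0, hγ1, hγ, hγs, -⟩ := exists_lt_locally_constant_of_riemannianEDist_lt hs zero_lt_one
  have hmem : ∀ t ∈ Icc (0 : ℝ) 1, γ t ∈ Metric.eball p δ := by
    intro t ht
    have h3 : edist (γ t) q.1 < δ / 3 + δ / 3 := by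
      rw [edist_comm, IsRiemannianManifold.out (I := 𝓘(ℝ, E))]
      calc _ ≤ pathELength 𝓘(ℝ, E) γ 0 t :=
            riemannianEDist_le_pathELength hγ.contMDiffOn hγ0 rfl ht.1
        _ ≤ pathELength 𝓘(ℝ, E) γ 0 1 := pathELength_mono le_rfl ht.2
        _ < _ := hγs.trans hsδ
    calc edist (γ t) p ≤ edist (γ t) q.1 + edist q.1 p := edist_triangle _ _ _
      _ < δ / 3 + δ / 3 + δ / 3 := ENNReal.add_lt_add h3 hy
      _ = δ := ENNReal.add_thirds δ
  have hsrc : ∀ t ∈ Icc (0 : ℝ) 1, γ t ∈ φ.source := fun t ht ↦ (hball (hmem t ht)).1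
  have hd : ∀ t ∈ Icc (0 : ℝ) 1, HasDerivWithinAt (T ∘ φ ∘ γ)
      (T ((trivializationAt E (TangentSpace 𝓘(ℝ, E) : M → Type _) p).continuousLinearMapAt ℝ (γ t)
        (mfderivWithin 𝓘(ℝ, ℝ) 𝓘(ℝ, E) γ (Icc 0 1) t 1))) (Icc 0 1) t := fun t ht ↦
    T.hasFDerivAt.comp_hasDerivWithinAt t (hasDerivWithinAt_extChartAt_comp
      (hγ.contMDiffOn.mdifferentiableOn one_ne_zero t ht) (hsrc t ht))
  have hCD : ContDiffOn ℝ 1 (T ∘ φ ∘ γ) (Icc 0 1) := by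
    refine T.contDiff.comp_contDiffOn ?_
    rw [← contMDiffOn_iff_contDiffOn]
    exact contMDiffOn_extChartAt.comp hγ.contMDiffOn fun t ht ↦ by
      have := hsrc t ht
      rwa [hφ, extChartAt_source] at this
  have h5 := enorm_sub_le_lintegral_derivWithin_Icc_of_contDiffOn_Icc hCD zero_le_one
  simp only [Function.comp_apply, hγ0, hγ1, ← map_sub] at h5
  refine absurd (h5.trans_lt ?_) (lt_irrefl _)
  calc _ ≤ ∫⁻ t in Icc (0 : ℝ) 1, r * ‖mfderivWithin 𝓘(ℝ, ℝ) 𝓘(ℝ, E) γ (Icc 0 1) t 1‖ₑ := by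
        refine setLIntegral_mono' measurableSet_Icc fun t ht ↦ ?_
        rw [(hd t ht).derivWithin (uniqueDiffOn_Icc zero_lt_one t ht)]
        exact (hball (hmem t ht)).2 _
    _ = r * pathELength 𝓘(ℝ, E) γ 0 1 := by
        rw [lintegral_const_mul' _ _ ENNReal.coe_ne_top, pathELength_eq_lintegral_mfderivWithin_Icc]
    _ ≤ r * s := by gcongr
    _ < _ := by rwa [mul_comm]

/-- In a chart around `p`, the distance is compared, with a factor arbitrarily close to `1` near
`p`, to a fixed norm on the model space. -/
theorem exists_seminorm_chart [IsRiemannianManifold 𝓘(ℝ, E) M] {x₀ p : M}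
    (hp : p ∈ (extChartAt 𝓘(ℝ, E) x₀).source) :
    ∃ (ν : Seminorm ℝ E) (C : ℝ), 0 < C ∧ (∀ v, ν v ≤ C * ‖v‖) ∧ (∀ v, ‖v‖ ≤ C * ν v) ∧
      ∀ r : ℝ≥0, 1 < r → ∀ᶠ q : M × M in 𝓝 (p, p),
        edist q.1 q.2 ≤ r * ENNReal.ofReal
          (ν (extChartAt 𝓘(ℝ, E) x₀ q.2 - extChartAt 𝓘(ℝ, E) x₀ q.1)) ∧
        ENNReal.ofReal (ν (extChartAt 𝓘(ℝ, E) x₀ q.2 - extChartAt 𝓘(ℝ, E) x₀ q.1)) ≤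
          r * edist q.1 q.2 := by
  obtain ⟨T, hT⟩ := exists_hasStrictFDerivAt_coordChange hp (mem_extChartAt_source (I := 𝓘(ℝ, E)) p)
  set φ := extChartAt 𝓘(ℝ, E) p with hφ
  set φ₀ := extChartAt 𝓘(ℝ, E) x₀ with hφ₀
  set A := (trivializationAt E (TangentSpace 𝓘(ℝ, E) : M → Type _) p).symmL ℝ p with hA
  set B := (trivializationAt E (TangentSpace 𝓘(ℝ, E) : M → Type _) p).continuousLinearMapAt ℝ p
    with hB
  have hBA : ∀ v, B (A v) = v := Trivialization.continuousLinearMapAt_symmL _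
    (FiberBundle.mem_baseSet_trivializationAt' p)
  -- The Riemannian norm at `p`, pulled back by the derivative `T` of the change from the chart at
  -- `x₀` to the chart at `p`.
  let ν : Seminorm ℝ E := (normSeminorm ℝ (TangentSpace 𝓘(ℝ, E) p)).comp
    ((A ∘L (T : E →L[ℝ] E) : E →L[ℝ] TangentSpace 𝓘(ℝ, E) p) : E →ₗ[ℝ] TangentSpace 𝓘(ℝ, E) p)
  have hν : ∀ v, ν v = ‖A (T v)‖ := fun v ↦ rfl
  set C := ‖A‖ * ‖(T : E →L[ℝ] E)‖ + ‖(T.symm : E →L[ℝ] E)‖ * ‖B‖ + 1 with hC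
  have hC0 : 0 < C := by positivity
  have hνle : ∀ v, ν v ≤ C * ‖v‖ := fun v ↦ by
    have h1 : ν v ≤ ‖A‖ * (‖(T : E →L[ℝ] E)‖ * ‖v‖) :=
      A.le_opNorm_of_le ((T : E →L[ℝ] E).le_opNorm v)
    have h2 : 0 ≤ ‖(T.symm : E →L[ℝ] E)‖ * ‖B‖ * ‖v‖ := by positivity
    rw [hC]; nlinarith [norm_nonneg v]
  have hleν : ∀ v, ‖v‖ ≤ C * ν v := fun v ↦ by
    have h1 : ‖v‖ ≤ ‖(T.symm : E →L[ℝ] E)‖ * (‖B‖ * ν v) := by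
      have := (T.symm : E →L[ℝ] E).le_opNorm_of_le (B.le_opNorm (A (T v)))
      simpa [hBA, hν] using this
    have h2 : 0 ≤ ‖A‖ * ‖(T : E →L[ℝ] E)‖ * ν v := by have := apply_nonneg ν v; positivity
    rw [hC]; nlinarith [apply_nonneg ν v]
  refine ⟨ν, C, hC0, hνle, hleν, fun r hr ↦ ?_⟩
  -- One factor `s` pays for comparing distance and norm in the chart at `p`, the other for
  -- linearizing the change of charts.
  set s := NNReal.sqrt r with hs
  have hss : s * s = r := NNReal.mul_self_sqrt r
  have hs1 : 1 < s := by
    by_contra! h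
    exact absurd (hss ▸ mul_le_one' h h) (not_le.2 hr)
  have hs1' : (1 : ℝ) < s := by exact_mod_cast hs1
  obtain ⟨κ, hκ, hκ1, hκ2⟩ : ∃ κ : ℝ, 0 < κ ∧ 1 + κ ≤ s ∧ 1 ≤ s * (1 - κ) := by
    refine ⟨(s - 1) / s, by have := sub_pos.2 hs1'; positivity, ?_, ?_⟩
    · have : ((s : ℝ) - 1) / s ≤ s - 1 := div_le_self (by linarith) hs1'.le
      linarith
    · field_simp; linarith
  have hε : 0 < κ / ((‖A‖ + 1) * C) := by positivity
  have h1 : ∀ᶠ q : M × M in 𝓝 (p, p), ‖φ q.2 - φ q.1 - T (φ₀ q.2 - φ₀ q.1)‖ ≤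
      κ / ((‖A‖ + 1) * C) * ‖φ₀ q.2 - φ₀ q.1‖ := by
    have h2 := (hasStrictFDerivAt_iff_isLittleO.1 hT).def hε
    have hc : ContinuousAt (fun q : M × M ↦ (φ₀ q.2, φ₀ q.1)) (p, p) :=
      ((continuousAt_extChartAt' hp).comp (x := (p, p)) continuousAt_snd).prodMk
        ((continuousAt_extChartAt' hp).comp (x := (p, p)) continuousAt_fst)
    have h3 : ∀ᶠ y in 𝓝 p, y ∈ φ₀.source := (isOpen_extChartAt_source x₀).mem_nhds hp
    have h4 := h3.prod_mk h3
    rw [← nhds_prod_eq] at h4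
    filter_upwards [hc.eventually h2, h4] with q h5 ⟨h6, h7⟩
    simpa [φ₀.left_inv h6, φ₀.left_inv h7] using h5
  filter_upwards [h1, eventually_edist_le_enorm_symmL (E := E) p hs1,
    eventually_enorm_symmL_le_edist (E := E) p hs1]
    with q h2 h3 h4
  set u := φ₀ q.2 - φ₀ q.1 with hu
  have hκu : ‖A (φ q.2 - φ q.1 - T u)‖ ≤ κ * ν u := by
    calc ‖A (φ q.2 - φ q.1 - T u)‖ ≤ ‖A‖ * (κ / ((‖A‖ + 1) * C) * (C * ν u)) :=
          A.le_opNorm_of_le (h2.trans (by gcongr; exact hleν u))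
      _ = ‖A‖ / (‖A‖ + 1) * (κ * ν u) := by field_simp
      _ ≤ 1 * (κ * ν u) := by
          have := apply_nonneg ν u
          gcongr
          rw [div_le_one (by positivity)]; linarith
      _ = κ * ν u := one_mul _
  rw [map_sub A] at hκu
  have h5 := abs_le.1 ((abs_norm_sub_norm_le _ _).trans hκu)
  rw [← hν] at h5
  have hup : ‖A (φ q.2 - φ q.1)‖ ≤ s * ν u := by nlinarith [apply_nonneg ν u]
  have hlo : ν u ≤ s * ‖A (φ q.2 - φ q.1)‖ := by nlinarith [apply_nonneg ν u]
  have hsE : ENNReal.ofReal (s : ℝ) = s := ENNReal.ofReal_coe_nnreal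
  rw [← hss, ENNReal.coe_mul]
  constructor
  · refine h3.trans ?_
    rw [mul_assoc]
    gcongr
    rw [← ofReal_norm, ← hsE, ← ENNReal.ofReal_mul s.coe_nonneg]
    exact ENNReal.ofReal_le_ofReal hup
  · refine (ENNReal.ofReal_le_ofReal hlo).trans ?_
    rw [ENNReal.ofReal_mul s.coe_nonneg, hsE, ofReal_norm, mul_assoc]
    gcongr

end Riemannian

/-! ### Reading maps in charts; admissible maps. -/

section ChartRep

variable {E : Type*} [NormedAddCommGroup E] [NormedSpace ℝ E]
  {E' : Type*} [NormedAddCommGroup E'] [NormedSpace ℝ E']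
  {M : Type*} [EMetricSpace M] [ChartedSpace E M]
  {N : Type*} [EMetricSpace N] [ChartedSpace E' N]

variable (E E') in
/-- The map `G` read in the charts at `x₀` and `y₀`. -/
noncomputable def chartRep (x₀ : M) (y₀ : N) (G : M → N) : E → E' :=
  extChartAt 𝓘(ℝ, E') y₀ ∘ G ∘ (extChartAt 𝓘(ℝ, E) x₀).symm

/-- The norm `ν` on the model space describes the distance near `p` in the chart at `x₀`, up to a
factor tending to `1`. -/
def IsDistNormAt (x₀ p : M) (ν : Seminorm ℝ E) : Prop :=
  ∃ C : ℝ, 0 < C ∧ (∀ v, ν v ≤ C * ‖v‖) ∧ (∀ v, ‖v‖ ≤ C * ν v) ∧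
    ∀ r : ℝ≥0, 1 < r → ∀ᶠ q : M × M in 𝓝 (p, p),
      edist q.1 q.2 ≤ r * ENNReal.ofReal
        (ν (extChartAt 𝓘(ℝ, E) x₀ q.2 - extChartAt 𝓘(ℝ, E) x₀ q.1)) ∧
      ENNReal.ofReal (ν (extChartAt 𝓘(ℝ, E) x₀ q.2 - extChartAt 𝓘(ℝ, E) x₀ q.1)) ≤
        r * edist q.1 q.2

theorem tendsto_extChartAt_symm {x₀ p : M} (hp : p ∈ (extChartAt 𝓘(ℝ, E) x₀).source) :
    Tendsto (extChartAt 𝓘(ℝ, E) x₀).symm (𝓝 (extChartAt 𝓘(ℝ, E) x₀ p)) (𝓝 p) := by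
  have := continuousAt_extChartAt_symm' (I := 𝓘(ℝ, E)) hp
  rwa [ContinuousAt, (extChartAt 𝓘(ℝ, E) x₀).left_inv hp] at this

theorem IsDistNormAt.eventually_chart {x₀ p : M} {ν : Seminorm ℝ E} (hν : IsDistNormAt x₀ p ν)
    (hp : p ∈ (extChartAt 𝓘(ℝ, E) x₀).source) {r : ℝ≥0} (hr : 1 < r) :
    ∀ᶠ q : E × E in 𝓝 (extChartAt 𝓘(ℝ, E) x₀ p, extChartAt 𝓘(ℝ, E) x₀ p),
      edist ((extChartAt 𝓘(ℝ, E) x₀).symm q.1) ((extChartAt 𝓘(ℝ, E) x₀).symm q.2) ≤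
        r * ENNReal.ofReal (ν (q.2 - q.1)) ∧
      ENNReal.ofReal (ν (q.2 - q.1)) ≤
        r * edist ((extChartAt 𝓘(ℝ, E) x₀).symm q.1) ((extChartAt 𝓘(ℝ, E) x₀).symm q.2) := by
  obtain ⟨C, -, -, -, h⟩ := hν
  have ht := (tendsto_extChartAt_symm hp).prodMap (tendsto_extChartAt_symm hp)
  rw [← nhds_prod_eq, ← nhds_prod_eq] at ht
  have h1 : ∀ᶠ a in 𝓝 (extChartAt 𝓘(ℝ, E) x₀ p), a ∈ (extChartAt 𝓘(ℝ, E) x₀).target :=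
    extChartAt_target_mem_nhds' ((extChartAt 𝓘(ℝ, E) x₀).map_source hp)
  have h2 := h1.prod_mk h1
  rw [← nhds_prod_eq] at h2
  filter_upwards [ht.eventually (h r hr), h2] with q hq ⟨hq1, hq2⟩
  simpa only [Prod.map_fst, Prod.map_snd, PartialEquiv.right_inv _ hq1,
    PartialEquiv.right_inv _ hq2] using hq

/-- Passing between manifold and chart costs a factor `r` in the source and another in the target; a
strict gap between `K` and `L` pays for both. -/
theorem exists_one_lt_sq_mul_lt {K L : ℝ≥0} (h : K < L) : ∃ r : ℝ≥0, 1 < r ∧ r * r * K < L := by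
  have h1 : Tendsto (fun r : ℝ≥0 ↦ r * r * K) (𝓝[>] 1) (𝓝 (1 * 1 * K)) :=
    (Continuous.tendsto (by fun_prop) _).mono_left nhdsWithin_le_nhds
  rw [one_mul, one_mul] at h1
  obtain ⟨r, h2, h3⟩ := ((h1.eventually (gt_mem_nhds h)).and self_mem_nhdsWithin).exists
  exact ⟨r, h3, h2⟩

theorem ofReal_le_coe_mul_ofReal {a b : ℝ} (hb : 0 ≤ b) {K : ℝ≥0} :
    ENNReal.ofReal a ≤ K * ENNReal.ofReal b ↔ a ≤ K * b := by
  rw [← ENNReal.ofReal_coe_nnreal, ← ENNReal.ofReal_mul K.coe_nonneg,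
    ENNReal.ofReal_le_ofReal_iff (by positivity)]

/-- A Lipschitz bound for `G` near `p` gives one for its reading in charts. -/
theorem eventually_seminorm_chartRep_le {x₀ p : M} {y₀ : N} {G : M → N}
    (hp : p ∈ (extChartAt 𝓘(ℝ, E) x₀).source)
    {ν : Seminorm ℝ E} (hν : IsDistNormAt x₀ p ν) {ν' : Seminorm ℝ E'}
    (hν' : IsDistNormAt y₀ (G p) ν') {K K₁ : ℝ≥0} (hK : K < K₁) {U : Set M} (hU : U ∈ 𝓝 p)
    (hG : LipschitzOnWith K G U) :
    ∀ᶠ q : E × E in 𝓝 (extChartAt 𝓘(ℝ, E) x₀ p, extChartAt 𝓘(ℝ, E) x₀ p),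
      ν' (chartRep E E' x₀ y₀ G q.2 - chartRep E E' x₀ y₀ G q.1) ≤ K₁ * ν (q.2 - q.1) := by
  obtain ⟨r, hr, hrK⟩ := exists_one_lt_sq_mul_lt hK
  obtain ⟨C', -, -, -, h'⟩ := hν'
  have hGc : ContinuousAt G p := hG.continuousOn.continuousAt hU
  have ht := (tendsto_extChartAt_symm hp).prodMap (tendsto_extChartAt_symm hp)
  have ht2 := (hGc.tendsto.comp (tendsto_extChartAt_symm hp)).prodMap
    (hGc.tendsto.comp (tendsto_extChartAt_symm hp))
  have hU2 : ∀ᶠ q : M × M in 𝓝 p ×ˢ 𝓝 p, q.1 ∈ U ∧ q.2 ∈ U :=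
    (eventually_mem_set.2 hU).prod_mk (eventually_mem_set.2 hU)
  rw [← nhds_prod_eq, ← nhds_prod_eq] at ht ht2
  rw [← nhds_prod_eq] at hU2
  filter_upwards [hν.eventually_chart hp hr, ht.eventually hU2, ht2.eventually (h' r hr)]
    with q h1 ⟨h2, h2'⟩ h3
  have h4 : ENNReal.ofReal (ν' (chartRep E E' x₀ y₀ G q.2 - chartRep E E' x₀ y₀ G q.1)) ≤
      (r * r * K : ℝ≥0) * ENNReal.ofReal (ν (q.2 - q.1)) := by
    calc _ ≤ r * edist (G ((extChartAt 𝓘(ℝ, E) x₀).symm q.1))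
          (G ((extChartAt 𝓘(ℝ, E) x₀).symm q.2)) := h3.2
      _ ≤ r * (K * (r * ENNReal.ofReal (ν (q.2 - q.1)))) := by
          gcongr
          exact (hG h2 h2').trans (by gcongr; exact h1.1)
      _ = _ := by push_cast; ring
  rw [ofReal_le_coe_mul_ofReal (apply_nonneg ν _)] at h4
  refine h4.trans ?_
  have := apply_nonneg ν (q.2 - q.1)
  gcongr

theorem exists_lipschitzOnWith_chartRep {x₀ p : M} {y₀ : N} {G : M → N}
    (hp : p ∈ (extChartAt 𝓘(ℝ, E) x₀).source)
    {ν : Seminorm ℝ E} (hν : IsDistNormAt x₀ p ν) {ν' : Seminorm ℝ E'}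
    (hν' : IsDistNormAt y₀ (G p) ν') {K : ℝ≥0} {U : Set M} (hU : U ∈ 𝓝 p)
    (hG : LipschitzOnWith K G U) :
    ∃ K' : ℝ≥0, ∃ R > 0,
      LipschitzOnWith K' (chartRep E E' x₀ y₀ G) (ball (extChartAt 𝓘(ℝ, E) x₀ p) R) := by
  have h := eventually_seminorm_chartRep_le hp hν hν' (lt_add_one K) hU hG
  obtain ⟨C, hC, hνC, -, -⟩ := hν
  obtain ⟨C', hC', -, hνC', -⟩ := hν'
  rw [nhds_prod_eq] at h
  obtain ⟨V, hV, hV'⟩ := eventually_prod_self_iff'.1 h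
  obtain ⟨R, hR, hRV⟩ := Metric.mem_nhds_iff.1 hV
  refine ⟨(C' * ((K + 1 : ℝ≥0) * C)).toNNReal, R, hR,
    LipschitzOnWith.of_dist_le_mul fun b hb a ha ↦ ?_⟩
  rw [dist_eq_norm, dist_eq_norm, Real.coe_toNNReal _ (by positivity)]
  calc _ ≤ C' * ν' (chartRep E E' x₀ y₀ G b - chartRep E E' x₀ y₀ G a) := hνC' _
    _ ≤ C' * ((K + 1 : ℝ≥0) * (C * ‖b - a‖)) := by
        gcongr
        exact (hV' _ (hRV ha) _ (hRV hb)).trans (by gcongr; exact hνC _)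
    _ = _ := by ring

variable (E E') in
/-- Near `p` the map `G` is Lipschitz with constant smaller than `L` and convexly expanding. -/
def IsAdmissibleAt (L : ℝ≥0) (G : M → N) (p : M) : Prop :=
  (∃ K < L, ∃ U ∈ 𝓝 p, LipschitzOnWith K G U) ∧
    ∀ x₀ y₀, p ∈ (extChartAt 𝓘(ℝ, E) x₀).source → G p ∈ (extChartAt 𝓘(ℝ, E') y₀).source →
      ConvexlyExpandingAt (chartRep E E' x₀ y₀ G) (extChartAt 𝓘(ℝ, E) x₀ p)

theorem IsAdmissibleAt.continuousAt {L : ℝ≥0} {G : M → N} {p : M}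
    (h : IsAdmissibleAt E E' L G p) : ContinuousAt G p := by
  obtain ⟨⟨K, -, U, hU, hG⟩, -⟩ := h
  exact hG.continuousOn.continuousAt hU

theorem IsAdmissibleAt.congr {L : ℝ≥0} {G G' : M → N} {p : M} (h : IsAdmissibleAt E E' L G p)
    (hG : G' =ᶠ[𝓝 p] G) : IsAdmissibleAt E E' L G' p := by
  obtain ⟨⟨K, hK, U, hU, hGU⟩, hce⟩ := h
  obtain ⟨V, hV, hGV⟩ := hG.exists_mem
  refine ⟨⟨K, hK, U ∩ V, inter_mem hU hV, fun a ha b hb ↦ ?_⟩, fun x₀ y₀ hx hy ↦ ?_⟩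
  · rw [hGV ha.2, hGV hb.2]
    exact hGU ha.1 hb.1
  · rw [hG.eq_of_nhds] at hy
    refine (hce x₀ y₀ hx hy).congr ?_
    filter_upwards [(tendsto_extChartAt_symm hx).eventually hG] with a ha
    simp only [chartRep, Function.comp_apply, ha]

end ChartRep

/-! ### Admissibility as a stable convex constraint. -/

section Admissible

variable {E : Type*} [NormedAddCommGroup E] [NormedSpace ℝ E]
  {E' : Type*} [NormedAddCommGroup E'] [NormedSpace ℝ E']
  {M : Type*} [EMetricSpace M] [ChartedSpace E M] [IsManifold 𝓘(ℝ, E) ∞ M]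
  [RiemannianBundle (fun x : M ↦ TangentSpace 𝓘(ℝ, E) x)]
  [IsContinuousRiemannianBundle E (fun x : M ↦ TangentSpace 𝓘(ℝ, E) x)]
  [IsRiemannianManifold 𝓘(ℝ, E) M]
  {N : Type*} [EMetricSpace N] [ChartedSpace E' N] [IsManifold 𝓘(ℝ, E') ∞ N]
  [RiemannianBundle (fun x : N ↦ TangentSpace 𝓘(ℝ, E') x)]
  [IsContinuousRiemannianBundle E' (fun x : N ↦ TangentSpace 𝓘(ℝ, E') x)]
  [IsRiemannianManifold 𝓘(ℝ, E') N]

theorem exists_isDistNormAt {x₀ p : M} (hp : p ∈ (extChartAt 𝓘(ℝ, E) x₀).source) :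
    ∃ ν : Seminorm ℝ E, IsDistNormAt x₀ p ν :=
  exists_seminorm_chart hp

/-- Convex expansion of a Lipschitz map does not depend on the charts. -/
theorem ConvexlyExpandingAt.chartRep_of_chartRep {x₀ x₁ p : M} {y₀ y₁ : N} {G : M → N}
    {K : ℝ≥0} {U : Set M} (hU : U ∈ 𝓝 p) (hG : LipschitzOnWith K G U)
    (hx₀ : p ∈ (extChartAt 𝓘(ℝ, E) x₀).source) (hy₀ : G p ∈ (extChartAt 𝓘(ℝ, E') y₀).source)
    (h : ConvexlyExpandingAt (chartRep E E' x₀ y₀ G) (extChartAt 𝓘(ℝ, E) x₀ p))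
    (hx₁ : p ∈ (extChartAt 𝓘(ℝ, E) x₁).source) (hy₁ : G p ∈ (extChartAt 𝓘(ℝ, E') y₁).source) :
    ConvexlyExpandingAt (chartRep E E' x₁ y₁ G) (extChartAt 𝓘(ℝ, E) x₁ p) := by
  obtain ⟨ν₀, hν₀⟩ := exists_isDistNormAt hx₀
  obtain ⟨ν₁, hν₁⟩ := exists_isDistNormAt hx₁
  obtain ⟨ν', hν'⟩ := exists_isDistNormAt hy₀
  obtain ⟨K₀, R₀, hR₀, hL₀⟩ := exists_lipschitzOnWith_chartRep hx₀ hν₀ hν' hU hG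
  obtain ⟨K₁, R₁, hR₁, hL₁⟩ := exists_lipschitzOnWith_chartRep hx₁ hν₁ hν' hU hG
  obtain ⟨T, hT⟩ := exists_hasStrictFDerivAt_coordChange hx₁ hx₀
  obtain ⟨T', hT'⟩ := exists_hasStrictFDerivAt_coordChange hy₀ hy₁
  have hGc : ContinuousAt G p := hG.continuousOn.continuousAt hU
  have hinv : (extChartAt 𝓘(ℝ, E) x₁).symm (extChartAt 𝓘(ℝ, E) x₁ p) = p :=
    (extChartAt 𝓘(ℝ, E) x₁).left_inv hx₁
  have hsym := tendsto_extChartAt_symm hx₁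
  have hτ : (extChartAt 𝓘(ℝ, E) x₀ ∘ (extChartAt 𝓘(ℝ, E) x₁).symm) (extChartAt 𝓘(ℝ, E) x₁ p) =
      extChartAt 𝓘(ℝ, E) x₀ p := by simp only [Function.comp_apply, hinv]
  have h1 : ConvexlyExpandingAt (chartRep E E' x₁ y₀ G) (extChartAt 𝓘(ℝ, E) x₁ p) := by
    rw [← hτ] at h hL₀
    refine (h.comp_right (ball_mem_nhds _ hR₀) hL₀ hT).congr ?_
    have h2 : ∀ᶠ q in 𝓝 p, q ∈ (extChartAt 𝓘(ℝ, E) x₀).source :=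
      (isOpen_extChartAt_source x₀).mem_nhds hx₀
    filter_upwards [hsym.eventually h2] with a ha
    simp only [chartRep, Function.comp_apply, PartialEquiv.left_inv _ ha]
  have hval : chartRep E E' x₁ y₀ G (extChartAt 𝓘(ℝ, E) x₁ p) = extChartAt 𝓘(ℝ, E') y₀ (G p) := by
    simp only [chartRep, Function.comp_apply, hinv]
  rw [← hval] at hT'
  refine (h1.comp_left (ball_mem_nhds _ hR₁) hL₁ hT').congr ?_
  have h2 : ∀ᶠ q in 𝓝 (G p), q ∈ (extChartAt 𝓘(ℝ, E') y₀).source :=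
    (isOpen_extChartAt_source y₀).mem_nhds hy₀
  filter_upwards [(hGc.tendsto.comp hsym).eventually h2] with a ha
  simp only [Function.comp_apply] at ha
  simp only [chartRep, Function.comp_apply, PartialEquiv.left_inv _ ha]

/-- Admissibility of `G` near `p` follows from a constraint on the increments of its reading `g` in
charts which has closed convex fibers and tolerates small relative errors. -/
theorem IsAdmissibleAt.exists_stable_constraint {L : ℝ≥0} {G : M → N} {x₀ p : M} {y₀ : N}
    (h : IsAdmissibleAt E E' L G p) (hp : p ∈ (extChartAt 𝓘(ℝ, E) x₀).source)
    (hGp : G p ∈ (extChartAt 𝓘(ℝ, E') y₀).source) {U : Set E}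
    (hU : U ∈ 𝓝 (extChartAt 𝓘(ℝ, E) x₀ p)) :
    ∃ r > 0, ∃ S : E → Set E', ∃ δ > 0, (∀ v, Convex ℝ (S v)) ∧ (∀ v, IsClosed (S v)) ∧
      ball (extChartAt 𝓘(ℝ, E) x₀ p) (2 * r) ⊆ U ∧
      (∀ a ∈ ball (extChartAt 𝓘(ℝ, E) x₀ p) (2 * r),
        ∀ b ∈ ball (extChartAt 𝓘(ℝ, E) x₀ p) (2 * r),
        chartRep E E' x₀ y₀ G b - chartRep E E' x₀ y₀ G a ∈ S (b - a)) ∧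
      ∀ g' : E → E', (∀ a, ‖g' a - chartRep E E' x₀ y₀ G a‖ ≤ δ) →
        (∀ a ∈ ball (extChartAt 𝓘(ℝ, E) x₀ p) r, ∀ b ∈ ball (extChartAt 𝓘(ℝ, E) x₀ p) r,
          ∃ w ∈ S (b - a), ‖g' b - g' a - w‖ ≤ δ * ‖b - a‖) →
        ∀ G' : M → N, (∀ q ∈ (extChartAt 𝓘(ℝ, E) x₀).source,
            extChartAt 𝓘(ℝ, E) x₀ q ∈ ball (extChartAt 𝓘(ℝ, E) x₀ p) r →
            G' q = (extChartAt 𝓘(ℝ, E') y₀).symm (g' (extChartAt 𝓘(ℝ, E) x₀ q))) →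
          ∀ q ∈ (extChartAt 𝓘(ℝ, E) x₀).source,
            extChartAt 𝓘(ℝ, E) x₀ q ∈ ball (extChartAt 𝓘(ℝ, E) x₀ p) r →
            IsAdmissibleAt E E' L G' q := by
  have hGc := h.continuousAt
  obtain ⟨⟨K, hKL, V, hV, hGV⟩, hce⟩ := h
  obtain ⟨c, hc, rc, hrc, hexp⟩ := hce x₀ y₀ hp hGp
  obtain ⟨ν, hν⟩ := exists_isDistNormAt hp
  obtain ⟨ν', hν'⟩ := exists_isDistNormAt hGp
  -- The gap from `K` to `L` is spent in three stages: `K < K₁` on reading `G` in charts, `K₁ < K₂`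
  -- on the smoothing error, and `s * s * K₂ < L` on returning to distances on the manifolds.
  obtain ⟨K₂, hK₂, hK₂L⟩ := exists_between hKL
  obtain ⟨K₁, hK₁, hK₁₂⟩ := exists_between hK₂
  obtain ⟨s, hs, hsL⟩ := exists_one_lt_sq_mul_lt hK₂L
  have hlip := eventually_seminorm_chartRep_le hp hν hν' hK₁ hV hGV
  have hdist := hν.eventually_chart hp hs
  have hdist' := hν'.eventually_chart hGp hs
  obtain ⟨C, hC, -, hCν, -⟩ := hν
  obtain ⟨C', hC', hCν', -, -⟩ := hν'
  set φ := extChartAt 𝓘(ℝ, E) x₀ with hφ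
  set ψ := extChartAt 𝓘(ℝ, E') y₀ with hψ
  set g := chartRep E E' x₀ y₀ G with hg
  choose l hl hlexp using hexp
  rw [nhds_prod_eq] at hlip hdist hdist'
  obtain ⟨V', hV', hdist'⟩ := eventually_prod_self_iff'.1 hdist'
  obtain ⟨ρ, hρ, hρV⟩ := Metric.mem_nhds_iff.1 (inter_mem hV'
    (extChartAt_target_mem_nhds' (ψ.map_source hGp)))
  have hgp : g (φ p) = ψ (G p) := by
    simp only [hg, chartRep, Function.comp_apply, ← hφ, φ.left_inv hp, hψ]
  have hgc : ContinuousAt g (φ p) := by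
    have h1 : Tendsto g (𝓝 (φ p)) (𝓝 (ψ (G p))) :=
      ((continuousAt_extChartAt' hGp).tendsto.comp hGc.tendsto).comp (tendsto_extChartAt_symm hp)
    rwa [ContinuousAt, hgp]
  obtain ⟨W, hW, hW'⟩ := eventually_prod_self_iff'.1 (hlip.and hdist)
  have hgρ : ∀ᶠ a in 𝓝 (φ p), g a ∈ ball (ψ (G p)) (ρ / 2) :=
    hgc.eventually (by rw [hgp]; exact ball_mem_nhds _ (half_pos hρ))
  obtain ⟨r₀, hr₀, hr₀'⟩ := Metric.mem_nhds_iff.1 (inter_mem (inter_mem hW hgρ) (inter_mem hU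
    (extChartAt_target_mem_nhds' (φ.map_source hp))))
  set r := min r₀ rc / 2 with hr
  have hrpos : 0 < r := half_pos (lt_min hr₀ hrc)
  have h2r : 2 * r = min r₀ rc := by rw [hr]; ring
  have hsub₀ : ball (φ p) (2 * r) ⊆ ball (φ p) r₀ := ball_subset_ball (h2r ▸ min_le_left _ _)
  have hsubc : ball (φ p) (2 * r) ⊆ ball (φ p) rc := ball_subset_ball (h2r ▸ min_le_right _ _)
  have hsubr : ball (φ p) r ⊆ ball (φ p) (2 * r) := ball_subset_ball (by linarith)
  have hK₁₂' : (K₁ : ℝ) < K₂ := by exact_mod_cast hK₁₂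
  -- The three bounds keep `g'` within the chart of the target, preserve half of the expansion, and
  -- keep the Lipschitz constant with respect to `ν`, `ν'` below `K₂`.
  obtain ⟨δ, hδ, hδρ, hδc, hδK⟩ : ∃ δ > 0, δ ≤ ρ / 3 ∧ δ ≤ c / 2 ∧ C' * δ * C ≤ K₂ - K₁ := by
    have : 0 < (K₂ : ℝ) - K₁ := sub_pos.2 hK₁₂'
    refine ⟨min (min (ρ / 3) (c / 2)) ((K₂ - K₁) / (C' * C)), by positivity,
      (min_le_left _ _).trans (min_le_left _ _), (min_le_left _ _).trans (min_le_right _ _), ?_⟩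
    calc C' * min (min (ρ / 3) (c / 2)) ((K₂ - K₁) / (C' * C)) * C
        ≤ C' * ((K₂ - K₁) / (C' * C)) * C := by gcongr; exact min_le_right _ _
      _ = K₂ - K₁ := by field_simp
  refine ⟨r, hrpos, fun v ↦ {w | ν' w ≤ K₁ * ν v} ∩ {w | c * ‖v‖ ≤ l v w}, δ, hδ, fun v ↦ ?_,
    fun v ↦ ?_, fun a ha ↦ (hr₀' (hsub₀ ha)).2.1, fun a ha b hb ↦ ⟨?_, ?_⟩, ?_⟩
  · refine Convex.inter ?_ (convex_halfSpace_ge (l v).isLinear _)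
    simpa using (ν'.convexOn.convex_le (K₁ * ν v))
  · have hν'c : Continuous ν' := (LipschitzWith.of_dist_le_mul (K := C'.toNNReal) fun a b ↦ by
      rw [Real.dist_eq, dist_eq_norm, Real.coe_toNNReal _ hC'.le]
      exact (abs_sub_map_le_sub ν' a b).trans (hCν' _)).continuous
    exact (isClosed_le hν'c continuous_const).inter (isClosed_le continuous_const (l v).continuous)
  · exact (hW' _ (hr₀' (hsub₀ ha)).1.1 _ (hr₀' (hsub₀ hb)).1.1).1
  · have := hlexp (b - a) a (hsubc ha) (by rw [add_sub_cancel]; exact hsubc hb)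
    rwa [add_sub_cancel] at this
  intro g' hg' hinc G' hG' q hq hqr
  have hmem : ∀ a ∈ ball (φ p) r, g' a ∈ ball (ψ (G p)) ρ := fun a ha ↦ by
    have h1 := mem_ball.1 (hr₀' (hsub₀ (hsubr ha))).1.2
    have h2 := hg' a
    rw [← dist_eq_norm] at h2
    exact mem_ball.2 ((dist_triangle _ (g a) _).trans_lt (by linarith))
  have hincr : ∀ a ∈ ball (φ p) r, ∀ b ∈ ball (φ p) r, ν' (g' b - g' a) ≤ K₂ * ν (b - a) := by
    intro a ha b hb
    obtain ⟨w, ⟨hw, -⟩, hwd⟩ := hinc a ha b hb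
    have hw' : ν' w ≤ K₁ * ν (b - a) := hw
    calc ν' (g' b - g' a) = ν' ((g' b - g' a - w) + w) := by rw [sub_add_cancel]
      _ ≤ ν' (g' b - g' a - w) + ν' w := map_add_le_add _ _ _
      _ ≤ C' * (δ * (C * ν (b - a))) + K₁ * ν (b - a) := by
          gcongr
          refine (hCν' _).trans ?_
          gcongr
          refine hwd.trans ?_
          gcongr
          exact hCν _
      _ = (C' * δ * C) * ν (b - a) + K₁ * ν (b - a) := by ring
      _ ≤ (K₂ - K₁) * ν (b - a) + K₁ * ν (b - a) := by
          have := apply_nonneg ν (b - a)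
          gcongr
      _ = K₂ * ν (b - a) := by ring
  have hopen : φ.source ∩ φ ⁻¹' ball (φ p) r ∈ 𝓝 q :=
    inter_mem ((isOpen_extChartAt_source x₀).mem_nhds hq)
      ((continuousAt_extChartAt' hq).preimage_mem_nhds (isOpen_ball.mem_nhds hqr))
  have hLip : LipschitzOnWith (s * s * K₂) G' (φ.source ∩ φ ⁻¹' ball (φ p) r) := by
    rintro q₁ ⟨hq₁, hq₁r⟩ q₂ ⟨hq₂, hq₂r⟩
    rw [hG' q₁ hq₁ hq₁r, hG' q₂ hq₂ hq₂r]
    have h1 := (hdist' _ (hρV (hmem _ hq₁r)).1 _ (hρV (hmem _ hq₂r)).1).1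
    have h2 := (hW' _ (hr₀' (hsub₀ (hsubr hq₁r))).1.1 _ (hr₀' (hsub₀ (hsubr hq₂r))).1.1).2.2
    simp only [φ.left_inv hq₁, φ.left_inv hq₂] at h2
    refine h1.trans ?_
    calc _ ≤ s * (K₂ * ENNReal.ofReal (ν (φ q₂ - φ q₁))) := by
          gcongr
          rw [ofReal_le_coe_mul_ofReal (apply_nonneg ν _)]
          exact hincr _ hq₁r _ hq₂r
      _ ≤ s * (K₂ * (s * edist q₁ q₂)) := by gcongr
      _ = _ := by push_cast; ring
  have hG'q : G' q ∈ ψ.source := by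
    rw [hG' q hq hqr]
    exact ψ.map_target (hρV (hmem _ hqr)).2
  refine ⟨⟨_, hsL, _, hopen, hLip⟩, fun x₁ y₁ hx₁ hy₁ ↦ ?_⟩
  -- Admissibility quantifies over all charts at `q`, but it is enough to check expansion in the
  -- charts at `x₀` and `y₀`.
  refine ConvexlyExpandingAt.chartRep_of_chartRep hopen hLip hq hG'q ?_ hx₁ hy₁
  have hg'e : ConvexlyExpandingAt g' (φ q) := by
    obtain ⟨r', hr', hr'sub⟩ := Metric.mem_nhds_iff.1 (isOpen_ball.mem_nhds hqr)
    refine ⟨c / 2, half_pos hc, r', hr', fun v ↦ ⟨l v, hl v, fun y hy hyv ↦ ?_⟩⟩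
    obtain ⟨w, ⟨-, hw⟩, hwd⟩ := hinc y (hr'sub hy) _ (hr'sub hyv)
    rw [add_sub_cancel_left] at hw hwd
    have hw' : c * ‖v‖ ≤ l v w := hw
    have h1 : |l v (g' (y + v) - g' y - w)| ≤ 1 * (δ * ‖v‖) :=
      (l v).le_of_opNorm_le_of_le (hl v) hwd
    have h2 := (abs_le.1 h1).1
    rw [map_sub] at h2
    nlinarith [norm_nonneg v]
  refine hg'e.congr ?_
  filter_upwards [isOpen_ball.mem_nhds hqr] with a ha
  have hat : a ∈ φ.target := (hr₀' (hsub₀ (hsubr ha))).2.2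
  have := hG' (φ.symm a) (φ.map_target hat) (by rwa [φ.right_inv hat])
  simp only [chartRep, Function.comp_apply, ← hφ, this, φ.right_inv hat]
  exact ψ.right_inv (hρV (hmem a ha)).2

end Admissible

/-! ### Smoothing admissible maps chart by chart. -/

section Smoothing

variable {E : Type*} [NormedAddCommGroup E] [NormedSpace ℝ E] [FiniteDimensional ℝ E]
  {E' : Type*} [NormedAddCommGroup E'] [NormedSpace ℝ E'] [FiniteDimensional ℝ E']
  {M : Type*} [EMetricSpace M] [ChartedSpace E M] [IsManifold 𝓘(ℝ, E) ∞ M]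
  [RiemannianBundle (fun x : M ↦ TangentSpace 𝓘(ℝ, E) x)]
  [IsContinuousRiemannianBundle E (fun x : M ↦ TangentSpace 𝓘(ℝ, E) x)]
  [IsRiemannianManifold 𝓘(ℝ, E) M]
  {N : Type*} [EMetricSpace N] [ChartedSpace E' N] [IsManifold 𝓘(ℝ, E') ∞ N]
  [RiemannianBundle (fun x : N ↦ TangentSpace 𝓘(ℝ, E') x)]
  [IsContinuousRiemannianBundle E' (fun x : N ↦ TangentSpace 𝓘(ℝ, E') x)]
  [IsRiemannianManifold 𝓘(ℝ, E') N]

/-- Admissible maps close to `F` can be smoothed near a point without losing admissibility. -/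
theorem exists_smoothing_near {F : M → N} (hF : Continuous F) (x₀ : M) :
    ∃ W ∈ 𝓝 x₀, ∃ r₀ : ℝ≥0∞, 0 < r₀ ∧ ∀ (L : ℝ≥0) (G : M → N), (∀ p, IsAdmissibleAt E E' L G p) →
      (∀ q, edist (F q) (G q) < r₀) → ∀ η : ℝ≥0∞, 0 < η →
      ∃ G' : M → N, (∀ p, IsAdmissibleAt E E' L G' p) ∧ (∀ q, edist (G q) (G' q) < η) ∧
        (∀ q ∈ W, ContMDiffAt 𝓘(ℝ, E) 𝓘(ℝ, E') ∞ G' q) ∧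
        ∀ q, ContMDiffAt 𝓘(ℝ, E) 𝓘(ℝ, E') ∞ G q → ContMDiffAt 𝓘(ℝ, E) 𝓘(ℝ, E') ∞ G' q := by
  classical
  set y₀ := F x₀ with hy₀
  set φ := extChartAt 𝓘(ℝ, E) x₀ with hφ
  set ψ := extChartAt 𝓘(ℝ, E') y₀ with hψ
  have hx₀ : x₀ ∈ φ.source := mem_extChartAt_source x₀
  obtain ⟨ε, hε, hεψ⟩ := EMetric.mem_nhds_iff.1 (extChartAt_source_mem_nhds (I := 𝓘(ℝ, E')) y₀)
  have hε2 : (0 : ℝ≥0∞) < ε / 2 := ENNReal.half_pos hε.ne'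
  have h1 : ∀ᶠ a in 𝓝 (φ x₀), edist (F (φ.symm a)) y₀ < ε / 2 :=
    (hF.continuousAt.tendsto.comp (tendsto_extChartAt_symm hx₀)).eventually
      (Metric.eball_mem_nhds _ hε2)
  obtain ⟨R, hR, hRs⟩ := Metric.nhds_basis_closedBall.mem_iff.1
    (inter_mem (extChartAt_target_mem_nhds (I := 𝓘(ℝ, E)) x₀) h1)
  have htarget : closedBall (φ x₀) R ⊆ φ.target := fun a ha ↦ (hRs ha).1
  have hpre : ∀ {ρ : ℝ} {q : M}, q ∈ φ.source → φ q ∈ ball (φ x₀) ρ →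
      φ.source ∩ φ ⁻¹' ball (φ x₀) ρ ∈ 𝓝 q := fun hq hqρ ↦
    inter_mem ((isOpen_extChartAt_source x₀).mem_nhds hq)
      ((continuousAt_extChartAt' hq).preimage_mem_nhds (isOpen_ball.mem_nhds hqρ))
  -- `W` and `r₀` depend on `F` alone, so a finite cover can be fixed in advance while the map `G`
  -- changes from step to step.
  refine ⟨φ.source ∩ φ ⁻¹' ball (φ x₀) (R / 4), hpre hx₀ (mem_ball_self (by positivity)), ε / 2,
    hε2, fun L G hG hFG η hη ↦ ?_⟩
  have hGc : Continuous G := continuous_iff_continuousAt.2 fun p ↦ (hG p).continuousAt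
  set g := chartRep E E' x₀ y₀ G with hg
  have hGψ : ∀ a ∈ closedBall (φ x₀) R, G (φ.symm a) ∈ ψ.source := fun a ha ↦ by
    apply hεψ
    calc edist (G (φ.symm a)) y₀ ≤ edist (F (φ.symm a)) (G (φ.symm a)) + edist (F (φ.symm a)) y₀ :=
          edist_triangle_left _ _ _
      _ < ε / 2 + ε / 2 := ENNReal.add_lt_add (hFG _) (hRs ha).2
      _ = ε := ENNReal.add_halves ε
  have hgψ : ∀ a ∈ closedBall (φ x₀) R, ψ.symm (g a) = G (φ.symm a) := fun a ha ↦
    ψ.left_inv (hGψ a ha)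
  have hgc : ContinuousOn g (closedBall (φ x₀) R) :=
    (continuousOn_extChartAt y₀).comp
      (hGc.comp_continuousOn ((continuousOn_extChartAt_symm x₀).mono htarget)) hGψ
  have hgK : IsCompact (g '' closedBall (φ x₀) R) := (isCompact_closedBall _ _).image_of_continuousOn hgc
  have hgt : g '' closedBall (φ x₀) R ⊆ ψ.target := by
    rintro _ ⟨a, ha, rfl⟩
    exact ψ.map_source (hGψ a ha)
  -- `δ₁` keeps the perturbed values inside the chart of the target; `δ₂` below turns closeness in
  -- that chart into distance less than `η`.
  obtain ⟨δ₁, hδ₁, hδ₁t⟩ := hgK.exists_thickening_subset_open (isOpen_extChartAt_target y₀) hgt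
  obtain ⟨δ₂, hδ₂, hδ₂u⟩ : ∃ δ₂ > 0, ∀ a ∈ closedBall (φ x₀) R, ∀ b, dist (g a) b < δ₂ →
      edist (G (φ.symm a)) (ψ.symm b) < η := by
    have := hgK.uniformContinuousAt_of_continuousAt ψ.symm (fun b hb ↦
      continuousAt_extChartAt_symm'' (hgt hb)) (edist_mem_uniformity hη)
    obtain ⟨δ₂, hδ₂, h⟩ := Metric.mem_uniformity_dist.1 this
    refine ⟨δ₂, hδ₂, fun a ha b hab ↦ ?_⟩
    rw [← hgψ a ha]
    exact h hab ⟨a, ha, rfl⟩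
  have hsub : closedBall (φ x₀) (R / 2) ⊆ ball (φ x₀) R := closedBall_subset_ball (by linarith)
  -- Every point of the half-radius ball has its own constraint; finitely many of their balls cover
  -- it, and the local smoothing respects all of these at once.
  have hloc : ∀ a : closedBall (φ x₀) (R / 2), _ := fun a ↦
    (hG (φ.symm a)).exists_stable_constraint (x₀ := x₀) (y₀ := y₀)
      (φ.map_target (htarget (ball_subset_closedBall (hsub a.2))))
      (hGψ _ (ball_subset_closedBall (hsub a.2))) (U := closedBall (φ x₀) R) (by
        rw [← hφ, φ.right_inv (htarget (ball_subset_closedBall (hsub a.2)))]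
        exact mem_of_superset (isOpen_ball.mem_nhds (hsub a.2)) ball_subset_closedBall)
  choose r hr S δ hδ hSc hScl hSsub hSg hSG using hloc
  simp only [← hφ, ← hψ, ← hg] at hSsub hSg hSG
  have hright : ∀ a : closedBall (φ x₀) (R / 2), φ (φ.symm a) = a := fun a ↦
    φ.right_inv (htarget (ball_subset_closedBall (hsub a.2)))
  simp only [hright] at hSsub hSg hSG
  obtain ⟨t, ht⟩ := (isCompact_closedBall (φ x₀) (R / 2)).elim_finite_subcover
    (fun a : closedBall (φ x₀) (R / 2) ↦ ball (a : E) (r a)) (fun a ↦ isOpen_ball)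
    fun a ha ↦ mem_iUnion.2 ⟨⟨a, ha⟩, mem_ball_self (hr _)⟩
  obtain ⟨δ₀, hδ₀, hδ₀₁, hδ₀₂, hδ₀t⟩ : ∃ δ₀ > 0, δ₀ < δ₁ ∧ δ₀ < δ₂ ∧ ∀ a ∈ t, δ₀ ≤ δ a := by
    have h2 : ∀ᶠ d in 𝓝[>] (0 : ℝ), d < δ₁ ∧ d < δ₂ ∧ ∀ a ∈ t, d ≤ δ a := by
      refine nhdsWithin_le_nhds ((gt_mem_nhds hδ₁).and ((gt_mem_nhds hδ₂).and ?_))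
      exact (Finset.eventually_all t).2 fun a _ ↦ ge_mem_nhds (hδ a)
    obtain ⟨d, h3, h4⟩ := (h2.and self_mem_nhdsWithin).exists
    exact ⟨d, h4, h3⟩
  borelize E
  obtain ⟨h, hoff, hclose, hinc, hsm, hsm'⟩ := exists_local_smoothing hR hgc
    (fun a : t ↦ (a.1 : E)) (fun a ↦ r a.1) (fun a ↦ hr a.1) (fun a ↦ S a.1) (fun a ↦ hSc a.1)
    (fun a ↦ hScl a.1) (fun a ↦ hSsub a.1) (fun a ↦ hSg a.1) hδ₀
  set G' : M → N := fun q ↦ if q ∈ φ.source ∧ φ q ∈ closedBall (φ x₀) (R / 2) then ψ.symm (h (φ q))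
    else G q with hG'
  have hG'eq : ∀ q ∈ φ.source, φ q ∈ closedBall (φ x₀) R → G' q = ψ.symm (h (φ q)) := by
    intro q hq hqR
    by_cases hq2 : φ q ∈ closedBall (φ x₀) (R / 2)
    · exact if_pos ⟨hq, hq2⟩
    · rw [hoff _ hq2, hgψ _ hqR, φ.left_inv hq]
      exact if_neg fun h ↦ hq2 h.2
  -- The half-radius ball has compact, hence closed, image in `M`, so off it `G'` agrees with `G` on
  -- a whole neighbourhood.
  have hfar : ∀ q, ¬ (q ∈ φ.source ∧ φ q ∈ closedBall (φ x₀) (R / 2)) → G' =ᶠ[𝓝 q] G := by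
    intro q hq
    have hZ : IsClosed (φ.symm '' closedBall (φ x₀) (R / 2)) :=
      ((isCompact_closedBall _ _).image_of_continuousOn ((continuousOn_extChartAt_symm x₀).mono
        ((hsub.trans ball_subset_closedBall).trans htarget))).isClosed
    have hqZ : q ∉ φ.symm '' closedBall (φ x₀) (R / 2) := by
      rintro ⟨a, ha, rfl⟩
      have hat := htarget (ball_subset_closedBall (hsub ha))
      exact hq ⟨φ.map_target hat, by rwa [φ.right_inv hat]⟩
    filter_upwards [hZ.isOpen_compl.mem_nhds hqZ] with z hz
    exact if_neg fun h ↦ hz ⟨φ z, h.2, φ.left_inv h.1⟩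
  have hsmooth : ∀ q ∈ φ.source, φ q ∈ ball (φ x₀) R → ContDiffAt ℝ ∞ h (φ q) →
      ContMDiffAt 𝓘(ℝ, E) 𝓘(ℝ, E') ∞ G' q := by
    intro q hq hqR hd
    have hht : h (φ q) ∈ ψ.target := hδ₁t (mem_thickening_iff.2
      ⟨g (φ q), ⟨_, ball_subset_closedBall hqR, rfl⟩, by
        rw [dist_eq_norm]; exact (hclose _).trans_lt hδ₀₁⟩)
    have hc : ContMDiffAt 𝓘(ℝ, E) 𝓘(ℝ, E') ∞ (ψ.symm ∘ h ∘ φ) q :=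
      ((contMDiffOn_extChartAt_symm y₀).contMDiffAt
        ((isOpen_extChartAt_target y₀).mem_nhds hht)).comp q
        (hd.contMDiffAt.comp q (contMDiffAt_extChartAt' (by rwa [← extChartAt_source 𝓘(ℝ, E)])))
    refine hc.congr_of_eventuallyEq ?_
    filter_upwards [hpre hq hqR] with z hz using hG'eq z hz.1 (ball_subset_closedBall hz.2)
  refine ⟨G', fun p ↦ ?_, fun q ↦ ?_, fun q hq ↦ ?_, fun q hq ↦ ?_⟩
  · by_cases hp : p ∈ φ.source ∧ φ p ∈ closedBall (φ x₀) (R / 2)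
    · obtain ⟨a, hat, ha⟩ := mem_iUnion₂.1 (ht hp.2)
      have hra : ball (a : E) (r a) ⊆ closedBall (φ x₀) R :=
        (ball_subset_ball (by linarith [hr a])).trans (hSsub a)
      refine hSG a h (fun b ↦ (hclose b).trans (hδ₀t a hat)) (fun b hb c hc ↦ ?_) G'
        (fun q hq hqa ↦ hG'eq q hq (hra hqa)) p hp.1 ha
      obtain ⟨w, hw, hwd⟩ := hinc ⟨a, hat⟩ b hb c hc
      exact ⟨w, hw, hwd.trans (by gcongr; exact hδ₀t a hat)⟩
    · exact (hG p).congr (hfar p hp)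
  · by_cases hp : q ∈ φ.source ∧ φ q ∈ closedBall (φ x₀) (R / 2)
    · have hqR := ball_subset_closedBall (hsub hp.2)
      rw [hG'eq q hp.1 hqR]
      have := hδ₂u (φ q) hqR (h (φ q)) (by
        rw [dist_comm, dist_eq_norm]; exact (hclose _).trans_lt hδ₀₂)
      rwa [φ.left_inv hp.1] at this
    · rw [(hfar q hp).eq_of_nhds, edist_self]
      exact hη
  · exact hsmooth q hq.1 (ball_subset_ball (by linarith) hq.2) (hsm _ hq.2)
  · by_cases hp : q ∈ φ.source ∧ φ q ∈ closedBall (φ x₀) (R / 2)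
    · refine hsmooth q hp.1 (hsub hp.2) (hsm' _ ?_)
      have hqs : (φ.symm (φ q)) = q := φ.left_inv hp.1
      have hqψ : G q ∈ ψ.source := by
        have := hGψ _ (ball_subset_closedBall (hsub hp.2))
        rwa [hqs] at this
      rw [← contMDiffAt_iff_contDiffAt]
      have h2 : ContMDiffAt 𝓘(ℝ, E) 𝓘(ℝ, E) ∞ φ.symm (φ q) :=
        (contMDiffOn_extChartAt_symm x₀).contMDiffAt
          ((isOpen_extChartAt_target x₀).mem_nhds (φ.map_source hp.1))
      rw [← hqs] at hq
      have h3 : ContMDiffAt 𝓘(ℝ, E') 𝓘(ℝ, E') ∞ ψ (G (φ.symm (φ q))) :=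
        contMDiffAt_extChartAt' (by rw [hqs]; rwa [← extChartAt_source 𝓘(ℝ, E')])
      exact h3.comp (φ q) (hq.comp (φ q) h2)
    · exact hq.congr_of_eventuallyEq (hfar q hp)

/-- An admissible map on a compact manifold is uniformly approximated by smooth admissible maps. -/
theorem exists_contMDiff_isAdmissibleAt [CompactSpace M] {L : ℝ≥0} {F : M → N}
    (hF : ∀ p, IsAdmissibleAt E E' L F p) {η : ℝ≥0∞} (hη : 0 < η) :
    ∃ G : M → N, (∀ p, IsAdmissibleAt E E' L G p) ∧ (∀ q, edist (F q) (G q) < η) ∧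
      ContMDiff 𝓘(ℝ, E) 𝓘(ℝ, E') ∞ G := by
  classical
  have hFc : Continuous F := continuous_iff_continuousAt.2 fun p ↦ (hF p).continuousAt
  choose W hW r hr hstep using exists_smoothing_near (E := E) (E' := E') hFc
  obtain ⟨t, -, ht⟩ := isCompact_univ.elim_nhds_subcover W fun x _ ↦ hW x
  have hind : ∀ (s : Finset M) (η : ℝ≥0∞), 0 < η → ∃ G : M → N, (∀ p, IsAdmissibleAt E E' L G p) ∧
      (∀ q, edist (F q) (G q) < η) ∧
      ∀ x ∈ s, ∀ q ∈ W x, ContMDiffAt 𝓘(ℝ, E) 𝓘(ℝ, E') ∞ G q := by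
    intro s
    induction s using Finset.induction_on with
    | empty => exact fun η hη ↦ ⟨F, hF, by simpa using fun _ ↦ hη, by simp⟩
    | insert x s hx ih =>
      intro η hη
      have hη2 : 0 < η / 2 := ENNReal.half_pos hη.ne'
      -- The tolerance `r x` keeps `G` close enough to `F` for the smoothing near `x` to apply;
      -- regions already smooth stay smooth.
      obtain ⟨G, hG, hFG, hGs⟩ := ih (min (η / 2) (r x)) (lt_min hη2 (hr x))
      obtain ⟨G', hG', hGG', hG'x, hG's⟩ := hstep x L G hG
        (fun q ↦ (hFG q).trans_le (min_le_right _ _)) _ hη2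
      refine ⟨G', hG', fun q ↦ ?_, fun y hy q hq ↦ ?_⟩
      · calc edist (F q) (G' q) ≤ edist (F q) (G q) + edist (G q) (G' q) := edist_triangle _ _ _
          _ < η / 2 + η / 2 :=
            ENNReal.add_lt_add ((hFG q).trans_le (min_le_left _ _)) (hGG' q)
          _ = η := ENNReal.add_halves η
      · rcases Finset.mem_insert.1 hy with rfl | hy
        · exact hG'x q hq
        · exact hG's q (hGs y hy q hq)
  obtain ⟨G, hG, hFG, hGs⟩ := hind t η hη
  refine ⟨G, hG, hFG, fun q ↦ ?_⟩
  obtain ⟨x, hx, hq⟩ := mem_iUnion₂.1 (ht (mem_univ q))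
  exact hGs x hx q hq

end Smoothing

/-! ### The Lipschitz constant as a supremum of quotients. -/

section LipschitzConstant

variable {X Y : Type*} [EMetricSpace X] [EMetricSpace Y]

theorem lipschitzConstant_le {f : X → Y} {K : ℝ≥0∞} (h : ∀ x y, edist (f x) (f y) ≤ K * edist x y) :
    lipschitzConstant f ≤ K := by
  refine iSup_le fun x ↦ iSup_le fun y ↦ iSup_le fun hxy ↦ ?_
  exact ENNReal.div_le_of_le_mul (h x y)

/-- Finiteness matters: a map taking different constant values on two components has constant `0`,
and `0 * ∞ = 0` does not bound the distance of these values. -/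
theorem edist_le_lipschitzConstant_mul (f : X → Y) {x y : X} (hxy : edist x y ≠ ⊤) :
    edist (f x) (f y) ≤ lipschitzConstant f * edist x y := by
  rcases eq_or_ne x y with rfl | hne
  · simp
  rw [← ENNReal.div_le_iff_le_mul (Or.inl (edist_pos.2 hne).ne') (Or.inl hxy)]
  exact le_iSup_of_le x (le_iSup_of_le y (le_iSup_of_le hne le_rfl))

theorem lipschitzOnWith_eball_lipschitzConstant {f : X → Y} (hf : lipschitzConstant f ≠ ⊤) (p : X) :
    LipschitzOnWith (lipschitzConstant f).toNNReal f (eball p 1) := by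
  intro x hx y hy
  rw [ENNReal.coe_toNNReal hf]
  refine edist_le_lipschitzConstant_mul f (ne_top_of_le_ne_top ?_ (edist_triangle_right x y p))
  exact (ENNReal.add_lt_add (mem_eball.1 hx) (mem_eball.1 hy)).ne_top

end LipschitzConstant

/-! ### Differentials on manifolds and derivatives in charts. -/

section Charts

variable {E : Type*} [NormedAddCommGroup E] [NormedSpace ℝ E]
  {E' : Type*} [NormedAddCommGroup E'] [NormedSpace ℝ E']
  {M : Type*} [EMetricSpace M] [ChartedSpace E M] [IsManifold 𝓘(ℝ, E) ∞ M]
  {N : Type*} [EMetricSpace N] [ChartedSpace E' N] [IsManifold 𝓘(ℝ, E') ∞ N]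

/-- The differential of `G`, read in charts, is the derivative of the reading of `G`. -/
theorem fderiv_chartRep_eq_inTangentCoordinates {G : M → N} {x q : M}
    (hq : q ∈ (extChartAt 𝓘(ℝ, E) x).source) (hGq : G q ∈ (extChartAt 𝓘(ℝ, E') (G x)).source)
    (hG : MDifferentiableAt 𝓘(ℝ, E) 𝓘(ℝ, E') G q) :
    inTangentCoordinates 𝓘(ℝ, E) 𝓘(ℝ, E') id G (fun y ↦ mfderiv 𝓘(ℝ, E) 𝓘(ℝ, E') G y) x q =
      fderiv ℝ (chartRep E E' x (G x) G) (extChartAt 𝓘(ℝ, E) x q) := by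
  have hqs : (extChartAt 𝓘(ℝ, E) x).symm (extChartAt 𝓘(ℝ, E) x q) = q :=
    (extChartAt 𝓘(ℝ, E) x).left_inv hq
  have hq' : q ∈ (chartAt E x).source := by rwa [← extChartAt_source 𝓘(ℝ, E)]
  have hGq' : G q ∈ (chartAt E' (G x)).source := by rwa [← extChartAt_source 𝓘(ℝ, E')]
  rw [inTangentCoordinates_eq_mfderiv_comp (f := id) hq' hGq', ← mfderiv_eq_fderiv]
  have h1 : MDifferentiableAt 𝓘(ℝ, E) 𝓘(ℝ, E) (extChartAt 𝓘(ℝ, E) x).symm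
      (extChartAt 𝓘(ℝ, E) x q) := by
    rw [← mdifferentiableWithinAt_univ, ← 𝓘(ℝ, E).range_eq_univ]
    exact mdifferentiableWithinAt_extChartAt_symm ((extChartAt 𝓘(ℝ, E) x).map_source hq)
  have h2 : MDifferentiableAt 𝓘(ℝ, E) 𝓘(ℝ, E') G
      ((extChartAt 𝓘(ℝ, E) x).symm (extChartAt 𝓘(ℝ, E) x q)) := by rwa [hqs]
  have h3 : MDifferentiableAt 𝓘(ℝ, E') 𝓘(ℝ, E') (extChartAt 𝓘(ℝ, E') (G x))
      (G ((extChartAt 𝓘(ℝ, E) x).symm (extChartAt 𝓘(ℝ, E) x q))) := by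
    rw [hqs]
    exact mdifferentiableAt_extChartAt hGq'
  have h4 : mfderivWithin 𝓘(ℝ, E) 𝓘(ℝ, E) (extChartAt 𝓘(ℝ, E) x).symm (range 𝓘(ℝ, E))
      (extChartAt 𝓘(ℝ, E) x q) =
      mfderiv 𝓘(ℝ, E) 𝓘(ℝ, E) (extChartAt 𝓘(ℝ, E) x).symm (extChartAt 𝓘(ℝ, E) x q) := by
    rw [ModelWithCorners.range_eq_univ, mfderivWithin_univ]
  have h5 := mfderiv_comp (extChartAt 𝓘(ℝ, E) x q) h3
    (h2.comp (extChartAt 𝓘(ℝ, E) x q) h1)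
  rw [mfderiv_comp (extChartAt 𝓘(ℝ, E) x q) h2 h1] at h5
  -- The equality `z = q` is eliminated for a variable `z`, because the types of the differentials
  -- depend on the base point.
  have h6 : ∀ z, z = q → ∀ C : E →L[ℝ] E,
      (show E →L[ℝ] E' from mfderiv 𝓘(ℝ, E') 𝓘(ℝ, E') (extChartAt 𝓘(ℝ, E') (G x)) (G z) ∘SL
        mfderiv 𝓘(ℝ, E) 𝓘(ℝ, E') G z ∘SL C) =
      (show E →L[ℝ] E' from mfderiv 𝓘(ℝ, E') 𝓘(ℝ, E') (extChartAt 𝓘(ℝ, E') (G x)) (G q) ∘SL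
        mfderiv 𝓘(ℝ, E) 𝓘(ℝ, E') G q ∘SL C) := by
    rintro z rfl C
    rfl
  exact (congrArg (fun C : E →L[ℝ] E ↦ (show E →L[ℝ] E' from
    mfderiv 𝓘(ℝ, E') 𝓘(ℝ, E') (extChartAt 𝓘(ℝ, E') (G x)) (G q) ∘SL
      mfderiv 𝓘(ℝ, E) 𝓘(ℝ, E') G q ∘SL C)) h4).trans ((h6 _ hqs _).symm.trans h5.symm)

theorem mdifferentiableAt_of_differentiableAt_chartRep {G : M → N} {x₀ q : M} {y₀ : N}
    (hGc : ContinuousAt G q) (hq : q ∈ (extChartAt 𝓘(ℝ, E) x₀).source)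
    (hGq : G q ∈ (extChartAt 𝓘(ℝ, E') y₀).source)
    (hG : DifferentiableAt ℝ (chartRep E E' x₀ y₀ G) (extChartAt 𝓘(ℝ, E) x₀ q)) :
    MDifferentiableAt 𝓘(ℝ, E) 𝓘(ℝ, E') G q := by
  have hqs : (extChartAt 𝓘(ℝ, E) x₀).symm (extChartAt 𝓘(ℝ, E) x₀ q) = q :=
    (extChartAt 𝓘(ℝ, E) x₀).left_inv hq
  have hval : chartRep E E' x₀ y₀ G (extChartAt 𝓘(ℝ, E) x₀ q) = extChartAt 𝓘(ℝ, E') y₀ (G q) := by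
    simp only [chartRep, Function.comp_apply, hqs]
  have h1 : MDifferentiableAt 𝓘(ℝ, E) 𝓘(ℝ, E) (extChartAt 𝓘(ℝ, E) x₀) q :=
    mdifferentiableAt_extChartAt (by rwa [← extChartAt_source 𝓘(ℝ, E)])
  have h2 : MDifferentiableAt 𝓘(ℝ, E') 𝓘(ℝ, E') (extChartAt 𝓘(ℝ, E') y₀).symm
      (chartRep E E' x₀ y₀ G (extChartAt 𝓘(ℝ, E) x₀ q)) := by
    rw [hval, ← mdifferentiableWithinAt_univ, ← 𝓘(ℝ, E').range_eq_univ]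
    exact mdifferentiableWithinAt_extChartAt_symm ((extChartAt 𝓘(ℝ, E') y₀).map_source hGq)
  refine (h2.comp q (hG.mdifferentiableAt.comp q h1)).congr_of_eventuallyEq ?_
  filter_upwards [(isOpen_extChartAt_source x₀).mem_nhds hq,
    hGc.preimage_mem_nhds ((isOpen_extChartAt_source y₀).mem_nhds hGq)] with z hz hGz
  simp only [chartRep, Function.comp_apply, PartialEquiv.left_inv _ hz]
  exact ((extChartAt 𝓘(ℝ, E') y₀).left_inv hGz).symm

/-- A map which is convexly expanding in charts has an injective differential. -/
theorem ConvexlyExpandingAt.mfderiv_injective {G : M → N} {p : M}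
    (h : ConvexlyExpandingAt (chartRep E E' p (G p) G) (extChartAt 𝓘(ℝ, E) p p))
    (hG : MDifferentiableAt 𝓘(ℝ, E) 𝓘(ℝ, E') G p) :
    Function.Injective (mfderiv 𝓘(ℝ, E) 𝓘(ℝ, E') G p) := by
  have h1 : HasFDerivWithinAt (chartRep E E' p (G p) G)
      (show E →L[ℝ] E' from mfderiv 𝓘(ℝ, E) 𝓘(ℝ, E') G p) univ (extChartAt 𝓘(ℝ, E) p p) := by
    rw [← 𝓘(ℝ, E).range_eq_univ]
    exact hG.hasMFDerivAt.2
  exact h.fderiv_injective (hasFDerivWithinAt_univ.1 h1)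

end Charts

/-! ### Non-singular points and the approximation theorem. -/

section Clarke

variable {E : Type*} [NormedAddCommGroup E] [NormedSpace ℝ E] [FiniteDimensional ℝ E]
  {E' : Type*} [NormedAddCommGroup E'] [InnerProductSpace ℝ E'] [FiniteDimensional ℝ E']
  {M : Type*} [EMetricSpace M] [ChartedSpace E M] [IsManifold 𝓘(ℝ, E) ∞ M]
  [RiemannianBundle (fun x : M ↦ TangentSpace 𝓘(ℝ, E) x)]
  [IsContinuousRiemannianBundle E (fun x : M ↦ TangentSpace 𝓘(ℝ, E) x)]
  [IsRiemannianManifold 𝓘(ℝ, E) M]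
  {N : Type*} [EMetricSpace N] [ChartedSpace E' N] [IsManifold 𝓘(ℝ, E') ∞ N]
  [RiemannianBundle (fun x : N ↦ TangentSpace 𝓘(ℝ, E') x)]
  [IsContinuousRiemannianBundle E' (fun x : N ↦ TangentSpace 𝓘(ℝ, E') x)]
  [IsRiemannianManifold 𝓘(ℝ, E') N]

/-- A Lipschitz map is convexly expanding at its non-singular points. -/
theorem IsNonsingularPoint.convexlyExpandingAt {F : M → N} {K : ℝ≥0} (hF : LipschitzWith K F)
    (hdim : Module.finrank ℝ E ≤ Module.finrank ℝ E') {x : M}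
    (hx : IsNonsingularPoint 𝓘(ℝ, E) 𝓘(ℝ, E') F x) :
    ConvexlyExpandingAt (chartRep E E' x (F x) F) (extChartAt 𝓘(ℝ, E) x x) := by
  have hxs : x ∈ (extChartAt 𝓘(ℝ, E) x).source := mem_extChartAt_source x
  have hys : F x ∈ (extChartAt 𝓘(ℝ, E') (F x)).source := mem_extChartAt_source (F x)
  obtain ⟨ν, hν⟩ := exists_isDistNormAt hxs
  obtain ⟨ν', hν'⟩ := exists_isDistNormAt hys
  obtain ⟨K', R, hR, hL⟩ := exists_lipschitzOnWith_chartRep hxs hν hν' univ_mem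
    (lipschitzOnWith_univ.2 hF)
  refine convexlyExpandingAt_of_injective hR hL fun A hA ↦ ?_
  have hsub : {A : E →L[ℝ] E' | ∃ u : ℕ → E, Tendsto u atTop (𝓝 (extChartAt 𝓘(ℝ, E) x x)) ∧
      (∀ i, DifferentiableAt ℝ (chartRep E E' x (F x) F) (u i)) ∧
      Tendsto (fun i ↦ fderiv ℝ (chartRep E E' x (F x) F) (u i)) atTop (𝓝 A)} ⊆
      limitingDifferentials 𝓘(ℝ, E) 𝓘(ℝ, E') F x := by
    rintro A ⟨u, hu, hd, hA⟩
    have hs := tendsto_extChartAt_symm hxs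
    have h1 : ∀ᶠ i in atTop, u i ∈ (extChartAt 𝓘(ℝ, E) x).target ∧
        F ((extChartAt 𝓘(ℝ, E) x).symm (u i)) ∈ (extChartAt 𝓘(ℝ, E') (F x)).source :=
      (hu.eventually (extChartAt_target_mem_nhds x)).and
        ((hF.continuous.continuousAt.tendsto.comp (hs.comp hu)).eventually
          (extChartAt_source_mem_nhds (F x)))
    -- A limiting differential requires differentiability at every index, so the finitely many terms
    -- outside the charts are dropped by a shift.
    obtain ⟨n, hn⟩ := eventually_atTop.1 h1
    have hmd : ∀ i, MDifferentiableAt 𝓘(ℝ, E) 𝓘(ℝ, E') F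
        ((extChartAt 𝓘(ℝ, E) x).symm (u (i + n))) := fun i ↦ by
      obtain ⟨h2, h3⟩ := hn (i + n) (Nat.le_add_left _ _)
      refine mdifferentiableAt_of_differentiableAt_chartRep hF.continuous.continuousAt
        ((extChartAt 𝓘(ℝ, E) x).map_target h2) h3 ?_
      rw [(extChartAt 𝓘(ℝ, E) x).right_inv h2]
      exact hd _
    refine ⟨fun i ↦ (extChartAt 𝓘(ℝ, E) x).symm (u (i + n)),
      (hs.comp hu).comp (tendsto_add_atTop_nat n), hmd, ?_⟩
    refine (hA.comp (tendsto_add_atTop_nat n)).congr fun i ↦ ?_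
    obtain ⟨h2, h3⟩ := hn (i + n) (Nat.le_add_left _ _)
    rw [fderiv_chartRep_eq_inTangentCoordinates ((extChartAt 𝓘(ℝ, E) x).map_target h2) h3 (hmd i),
      (extChartAt 𝓘(ℝ, E) x).right_inv h2]
    rfl
  -- As `dim E ≤ dim E'`, maximal rank is `dim E`, so rank-nullity leaves a trivial kernel.
  have hrank := hx A (convexHull_mono hsub hA)
  rw [min_eq_left hdim] at hrank
  have hker := LinearMap.finrank_range_add_finrank_ker (A : E →ₗ[ℝ] E')
  have h0 : Module.finrank ℝ (LinearMap.ker (A : E →ₗ[ℝ] E')) = 0 := by omega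
  exact LinearMap.ker_eq_bot.1 (Submodule.finrank_eq_zero.1 h0)

theorem exists_immersion_of_isNonsingularPoint [CompactSpace M]
    (hdim : Module.finrank ℝ E ≤ Module.finrank ℝ E') {F : M → N}
    (hF : ∃ K : ℝ≥0, LipschitzWith K F)
    (hns : ∀ x : M, IsNonsingularPoint 𝓘(ℝ, E) 𝓘(ℝ, E') F x) {η : ℝ} (hη : 0 < η) :
    ∃ f : M → N, (ContMDiff 𝓘(ℝ, E) 𝓘(ℝ, E') ∞ f ∧
        ∀ x : M, Function.Injective (mfderiv 𝓘(ℝ, E) 𝓘(ℝ, E') f x)) ∧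
      (∀ x : M, edist (F x) (f x) < ENNReal.ofReal η) ∧
      lipschitzConstant f ≤ lipschitzConstant F * ENNReal.ofReal (1 + η) := by
  obtain ⟨K, hK⟩ := hF
  have hη' : (0 : ℝ≥0∞) < ENNReal.ofReal η := ENNReal.ofReal_pos.2 hη
  have htop : lipschitzConstant F ≠ ⊤ :=
    ne_top_of_le_ne_top ENNReal.coe_ne_top (lipschitzConstant_le hK)
  have hball : ∀ p : M, eball p 1 ∈ 𝓝 p := fun p ↦ Metric.eball_mem_nhds p one_pos
  have hLip := lipschitzOnWith_eball_lipschitzConstant htop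
  have hce := fun x ↦ (hns x).convexlyExpandingAt hK hdim
  rcases isEmpty_or_nonempty M with hM | ⟨⟨p₀⟩⟩
  · exact ⟨F, ⟨fun x ↦ hM.elim x, fun x ↦ hM.elim x⟩, fun x ↦ hM.elim x,
      lipschitzConstant_le fun x ↦ hM.elim x⟩
  -- In dimension `0` the Lipschitz constant may vanish, leaving no slack, but then `F` is itself a
  -- smooth immersion.
  rcases subsingleton_or_nontrivial E with hE | hE
  · have hcd : ∀ g : E → E', ContDiff ℝ ∞ g := fun g ↦ by
      rw [show g = fun _ ↦ g 0 from funext fun v ↦ congrArg g (Subsingleton.elim v 0)]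
      exact contDiff_const
    refine ⟨F, ⟨fun x ↦ ?_, fun x ↦ ?_⟩, fun x ↦ by simpa using hη, ?_⟩
    · rw [contMDiffAt_iff]
      exact ⟨hK.continuous.continuousAt, (hcd _).contDiffWithinAt⟩
    · exact fun v w _ ↦ Subsingleton.elim (α := E) v w
    · refine le_mul_of_one_le_right' ?_
      rw [ENNReal.one_le_ofReal]
      linarith
  set k := (lipschitzConstant F).toNNReal with hk
  -- With constant `0` the map would be locally constant, contradicting expansion along a nonzero
  -- vector. Positivity of `k` makes `k < k * (1 + η)` strict, as admissibility demands.
  have hkpos : 0 < k := by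
    rw [pos_iff_ne_zero]
    intro hk0
    obtain ⟨c, hc, r, hr, h⟩ := hce p₀
    have hconst : ∀ᶠ a in 𝓝 (extChartAt 𝓘(ℝ, E) p₀ p₀),
        chartRep E E' p₀ (F p₀) F a = extChartAt 𝓘(ℝ, E') (F p₀) (F p₀) := by
      filter_upwards [(tendsto_extChartAt_symm (mem_extChartAt_source p₀)).eventually
        (hball p₀)] with a ha
      have := hLip p₀ ha (mem_of_mem_nhds (hball p₀))
      rw [hk0, ENNReal.coe_zero, zero_mul, nonpos_iff_eq_zero, edist_eq_zero] at this
      simp only [chartRep, Function.comp_apply, this]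
    obtain ⟨s, hs, hs'⟩ := Metric.eventually_nhds_iff_ball.1 hconst
    obtain ⟨v, hv'⟩ := exists_norm_eq E (half_pos (lt_min hr hs)).le
    have hv : 0 < ‖v‖ := hv' ▸ half_pos (lt_min hr hs)
    have hvs : ‖v‖ < min r s := hv' ▸ half_lt_self (lt_min hr hs)
    obtain ⟨l, -, hl⟩ := h v
    have hva : ∀ {ρ : ℝ}, min r s ≤ ρ →
        extChartAt 𝓘(ℝ, E) p₀ p₀ + v ∈ ball (extChartAt 𝓘(ℝ, E) p₀ p₀) ρ := fun hρ ↦ by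
      simpa using hvs.trans_le hρ
    have h1 := hl _ (mem_ball_self hr) (hva (min_le_left _ _))
    rw [hs' _ (mem_ball_self hs), hs' _ (hva (min_le_right _ _)), sub_self, map_zero] at h1
    exact absurd h1 (not_le.2 (by positivity))
  set L : ℝ≥0 := k * (1 + η).toNNReal with hL
  have hη1 : 1 < (1 + η).toNNReal := by
    rw [Real.lt_toNNReal_iff_coe_lt]
    simpa using hη
  have hkL : k < L := lt_mul_of_one_lt_right hkpos hη1
  have hadm : ∀ p, IsAdmissibleAt E E' L F p := fun p ↦
    ⟨⟨k, hkL, _, hball p, hLip p⟩, fun x₀ y₀ hx hy ↦ (hce p).chartRep_of_chartRep (hball p) (hLip p)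
      (mem_extChartAt_source p) (mem_extChartAt_source (F p)) hx hy⟩
  obtain ⟨f, hf, hFf, hsm⟩ := exists_contMDiff_isAdmissibleAt hadm hη'
  refine ⟨f, ⟨hsm, fun x ↦ ?_⟩, hFf, ?_⟩
  · exact ((hf x).2 x (f x) (mem_extChartAt_source x)
      (mem_extChartAt_source (f x))).mfderiv_injective ((hsm x).mdifferentiableAt (by simp))
  · have hLE : (L : ℝ≥0∞) = lipschitzConstant F * ENNReal.ofReal (1 + η) := by
      rw [hL, ENNReal.coe_mul, hk, ENNReal.coe_toNNReal htop]
      rfl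
    rw [← hLE]
    refine lipschitzConstant_le (edist_le_of_locally_lipschitz (E := E) (hkpos.trans hkL) fun p ↦ ?_)
    obtain ⟨⟨K', hK', U, hU, hfU⟩, -⟩ := hf p
    exact ⟨U, hU, hfU.weaken hK'.le⟩

end Clarke

/-! ### Smooth Riemannian metrics are continuous. -/

section RiemannianBundle

variable {EB : Type*} [NormedAddCommGroup EB] [NormedSpace ℝ EB]
  {HB : Type*} [TopologicalSpace HB] (IB : ModelWithCorners ℝ EB HB) (n : ℕ∞ω)
  {B : Type*} [TopologicalSpace B] [ChartedSpace HB B]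
  (F : Type*) [NormedAddCommGroup F] [NormedSpace ℝ F]
  (V : B → Type*) [TopologicalSpace (TotalSpace F V)] [∀ x, NormedAddCommGroup (V x)]
  [∀ x, InnerProductSpace ℝ (V x)] [FiberBundle F V] [VectorBundle ℝ F V]

theorem isContinuousRiemannianBundle_of_isContMDiffRiemannianBundle
    [h : IsContMDiffRiemannianBundle IB n F V] : IsContinuousRiemannianBundle F V := by
  obtain ⟨g, hg, hg'⟩ := h.exists_contMDiff
  exact ⟨g, hg.continuous, hg'⟩

end RiemannianBundle

end

theorem mainTheorem1 {m n : ℕ} (hmn : m ≤ n)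
    {M : Type*} [EMetricSpace M] [CompactSpace M]
    [ChartedSpace (EuclideanSpace ℝ (Fin m)) M] [IsManifold (𝓡 m) ∞ M]
    [RiemannianBundle (fun x : M ↦ TangentSpace (𝓡 m) x)]
    [IsContMDiffRiemannianBundle (𝓡 m) ∞ (EuclideanSpace ℝ (Fin m))
      (fun x : M ↦ TangentSpace (𝓡 m) x)]
    [IsRiemannianManifold (𝓡 m) M]
    {N : Type*} [EMetricSpace N]
    [ChartedSpace (EuclideanSpace ℝ (Fin n)) N] [IsManifold (𝓡 n) ∞ N]
    [RiemannianBundle (fun y : N ↦ TangentSpace (𝓡 n) y)]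
    [IsContMDiffRiemannianBundle (𝓡 n) ∞ (EuclideanSpace ℝ (Fin n))
      (fun y : N ↦ TangentSpace (𝓡 n) y)]
    [IsRiemannianManifold (𝓡 n) N]
    (F : M → N) (hF : ∃ K : ℝ≥0, LipschitzWith K F)
    (hns : ∀ x : M, IsNonsingularPoint (𝓡 m) (𝓡 n) F x)
    (η : ℝ) (hη : 0 < η) :
    ∃ f : M → N,
      (ContMDiff (𝓡 m) (𝓡 n) ∞ f ∧
        ∀ x : M, Function.Injective (mfderiv (𝓡 m) (𝓡 n) f x)) ∧
      (∀ x : M, edist (F x) (f x) < ENNReal.ofReal η) ∧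
      lipschitzConstant f ≤ lipschitzConstant F * ENNReal.ofReal (1 + η) := by
  have := isContinuousRiemannianBundle_of_isContMDiffRiemannianBundle (𝓡 m) ∞
    (EuclideanSpace ℝ (Fin m)) (fun x : M ↦ TangentSpace (𝓡 m) x)
  have := isContinuousRiemannianBundle_of_isContMDiffRiemannianBundle (𝓡 n) ∞
    (EuclideanSpace ℝ (Fin n)) (fun y : N ↦ TangentSpace (𝓡 n) y)
  exact exists_immersion_of_isNonsingularPoint (by simpa using hmn) hF hns hη
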